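/- There is an absolute constant $c>0$ such that the following holds. Let $T,n\ge 1$, let $u_1,\dots,u_T\in\mathbb{R}^n$ be non-zero vectors, and set $\|u_{\min}\|=\min_t\|u_t\|$ (Euclidean norm). Let $S:\mathbb{R}^{Tn}\to\mathbb{R}^{Tn}$ be the summation operator $(Sx)_t=\sum_{i\le t}x_i$ for $x=(x_1,\dots,x_T)$ with $x_i\in\mathbb{R}^n$, and let $O_u:\mathbb{R}^{Tn}\to\mathbb{R}^{T}$ be given by $(O_ux)_t=\langle u_t,x_t\rangle$. Let $O_uS=U\,\mathrm{Diag}(\gamma_1,\dots,\gamma_T)\,W$ be any singular value decomposition with $\gamma_1\ge\dots\ge\gamma_T>0$, let $R$ be the Moore–Penrose inverse of $O_uS$, and for $1\le p\le T$ let $$R'=W^{*}\,\mathrm{Diag}(0,\dots,0,\gamma_{T-p+1}^{-1},\dots,\gamma_T^{-1})\,U^{*}$$ be $R$ truncated to its $p$ largest singular values. Let $\sigma,\eta\in\mathbb{R}$ and $\kappa>0$, and let $Y=O_uSh+z$, where $h$ and $z$ are independent random vectors in $\mathbb{R}^{Tn}$ and $\mathbb{R}^T$, each with independent coordinates, such that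 every coordinate $X$ of $h$ (respectively of $z$) satisfies $\mathbb{E}X=0$, $\mathbb{E}X^2=\sigma^2$ (respectively $\mathbb{E}X^2=\eta^2$), and $\mathbb{P}(|X|>t)\le 2\exp(-t^2/\kappa^2)$ for all $t>0$. Write $\|\cdot\|_{HS}$ for the Hilbert–Schmidt norm. Then for every $0<\delta<1$, $$\mathbb{P}\left(\left|\frac{\|RY\|^2}{T}-\Big(\sigma^2+\frac{\|R\|_{HS}^2}{T}\eta^2\Big)\right|\ge c\,\frac{(1+\kappa^2)(1+\|u_{\min}\|^{-2})\log\frac1\delta}{\sqrt T}\right)\le 4\delta,$$ $$\mathbb{P}\left(\left|\frac{\|R'Y\|^2}{p}-\Big(\sigma^2+\frac{\|R'\|_{HS}^2}{p}\eta^2\Big)\right|\ge c\,\frac{(1+\kappa^2)(1+\|u_{\min}\|^{-2})\log\frac1\delta}{\sqrt p}\right)\le 4\delta .$$ -/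

import Mathlib

open MeasureTheory ProbabilityTheory
open scoped Matrix

namespace VarEst

noncomputable section

/-- The summation operator `S` on `ℝ^{Tn}`. A vector of `ℝ^{Tn}`, the concatenation of `T` vectors of
`ℝ^n`, is indexed by pairs (time, coordinate). -/
def sumMat (T n : ℕ) : Matrix (Fin T × Fin n) (Fin T × Fin n) ℝ :=
  Matrix.of fun a b => if b.1 ≤ a.1 ∧ b.2 = a.2 then 1 else 0

/-- The observation operator `O_u : ℝ^{Tn} → ℝ^T`. -/
def obsMat {T n : ℕ} (u : Fin T → EuclideanSpace ℝ (Fin n)) : Matrix (Fin T) (Fin T × Fin n) ℝ :=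
  Matrix.of fun t b => if b.1 = t then u t b.2 else 0

/-- `(S h)_{t,j} = ∑_{i ≤ t} h_{i,j}`. -/
theorem sumMat_mulVec {T n : ℕ} (h : Fin T × Fin n → ℝ) (t : Fin T) (j : Fin n) :
    (sumMat T n *ᵥ h) (t, j) = ∑ i ∈ Finset.Iic t, h (i, j) := by
  simp only [sumMat, Matrix.mulVec, dotProduct, Matrix.of_apply, Fintype.sum_prod_type, ite_mul,
    one_mul, zero_mul, ite_and]
  rw [← Finset.sum_filter_add_sum_filter_not Finset.univ (fun i : Fin T => i ≤ t)]
  rw [Finset.sum_eq_zero (s := Finset.univ.filter fun i : Fin T => ¬ i ≤ t), add_zero]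
  · refine Finset.sum_congr (by ext; simp) fun i hi => ?_
    have : i ≤ t := Finset.mem_Iic.1 hi
    simp [this]
  · intro i hi
    have : ¬ i ≤ t := (Finset.mem_filter.1 hi).2
    simp [this]

/-- `(O_u x)_t = ⟨u_t, x_t⟩`. -/
theorem obsMat_mulVec {T n : ℕ} (u : Fin T → EuclideanSpace ℝ (Fin n)) (x : Fin T × Fin n → ℝ)
    (t : Fin T) : (obsMat u *ᵥ x) t = ∑ j, u t j * x (t, j) := by
  simp only [obsMat, Matrix.mulVec, dotProduct, Matrix.of_apply, Fintype.sum_prod_type, ite_mul,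
    zero_mul]
  rw [Finset.sum_eq_single t] <;> simp +contextual

/-- `R` is the Moore-Penrose inverse of `A`. -/
structure IsMoorePenroseInverse {m k : Type*} [Fintype m] [Fintype k]
    (A : Matrix m k ℝ) (R : Matrix k m ℝ) : Prop where
  mul_mul_left : A * R * A = A
  mul_mul_right : R * A * R = R
  symm_left : (A * R)ᵀ = A * R
  symm_right : (R * A)ᵀ = R * A

/-- A singular value decomposition `A = U ∘ Diag(γ) ∘ W` of a `T`-row matrix of rank `T`:
`U` is orthogonal, `W` has orthonormal rows and `γ` is positive and non-increasing. -/
structure SVD {T : ℕ} {k : Type*} [Fintype k] (A : Matrix (Fin T) k ℝ) where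
  U : Matrix (Fin T) (Fin T) ℝ
  γ : Fin T → ℝ
  W : Matrix (Fin T) k ℝ
  orth_U : Uᵀ * U = 1
  orth_W : W * Wᵀ = 1
  pos : ∀ i, 0 < γ i
  anti : Antitone γ
  eq : A = U * Matrix.diagonal γ * W

/-- `R' = W* ∘ Diag(0, …, 0, χ_p, …, χ_1) ∘ U*`: the pseudo-inverse of `A` truncated to its `p`
largest singular values, which are the inverses `χ_1 ≥ … ≥ χ_p` of the last `p` entries of `γ`. -/
def SVD.truncPinv {T : ℕ} {k : Type*} [Fintype k] {A : Matrix (Fin T) k ℝ} (D : SVD A) (p : ℕ) :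
    Matrix k (Fin T) ℝ :=
  D.Wᵀ * Matrix.diagonal (fun i : Fin T => if T - p ≤ (i : ℕ) then (D.γ i)⁻¹ else 0) * D.Uᵀ

/-- The untruncated case is the Moore-Penrose inverse. -/
theorem SVD.isMoorePenroseInverse {T : ℕ} {k : Type*} [Fintype k] {A : Matrix (Fin T) k ℝ}
    (D : SVD A) : IsMoorePenroseInverse A (D.truncPinv T) := by
  have hU' : D.U * D.Uᵀ = 1 := mul_eq_one_comm.1 D.orth_U
  have hd : Matrix.diagonal D.γ * Matrix.diagonal (fun i => (D.γ i)⁻¹) = 1 := by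
    rw [Matrix.diagonal_mul_diagonal, ← Matrix.diagonal_one]
    congr 1; ext i; exact mul_inv_cancel₀ (D.pos i).ne'
  have hR : D.truncPinv T = D.Wᵀ * Matrix.diagonal (fun i => (D.γ i)⁻¹) * D.Uᵀ := by
    simp [SVD.truncPinv]
  have hAR : A * D.truncPinv T = 1 := by
    rw [hR]
    calc A * (D.Wᵀ * Matrix.diagonal (fun i => (D.γ i)⁻¹) * D.Uᵀ)
        = D.U * Matrix.diagonal D.γ * D.W *
            (D.Wᵀ * Matrix.diagonal (fun i => (D.γ i)⁻¹) * D.Uᵀ) := by rw [← D.eq]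
      _ = D.U * (Matrix.diagonal D.γ * (D.W * D.Wᵀ) *
            Matrix.diagonal (fun i => (D.γ i)⁻¹)) * D.Uᵀ := by simp only [Matrix.mul_assoc]
      _ = 1 := by rw [D.orth_W, Matrix.mul_one, hd, Matrix.mul_one, hU']
  have hRA : D.truncPinv T * A = D.Wᵀ * D.W := by
    rw [hR]
    calc D.Wᵀ * Matrix.diagonal (fun i => (D.γ i)⁻¹) * D.Uᵀ * A
        = D.Wᵀ * Matrix.diagonal (fun i => (D.γ i)⁻¹) * D.Uᵀ *
            (D.U * Matrix.diagonal D.γ * D.W) := by rw [← D.eq]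
      _ = D.Wᵀ * (Matrix.diagonal (fun i => (D.γ i)⁻¹) * (D.Uᵀ * D.U) * Matrix.diagonal D.γ) *
            D.W := by simp only [Matrix.mul_assoc]
      _ = D.Wᵀ * D.W := by rw [D.orth_U, Matrix.mul_one, mul_eq_one_comm.1 hd, Matrix.mul_one]
  refine ⟨by rw [hAR, Matrix.one_mul], by rw [Matrix.mul_assoc, hAR, Matrix.mul_one],
    by rw [hAR, Matrix.transpose_one], by rw [hRA]; simp⟩

/-- A matrix with linearly independent rows has such a decomposition. -/
theorem SVD.nonempty_of_posDef {T : ℕ} {k : Type*} [Fintype k] {A : Matrix (Fin T) k ℝ}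
    (hA : (A * Aᵀ).PosDef) : Nonempty (SVD A) := by
  set V : Matrix (Fin T) (Fin T) ℝ := hA.1.eigenvectorUnitary.1 with hV
  set lam := hA.1.eigenvalues with hl
  have hVV : Vᵀ * V = 1 := (Matrix.mem_unitaryGroup_iff'.1 hA.1.eigenvectorUnitary.2)
  have hsp : A * Aᵀ = V * Matrix.diagonal lam * Vᵀ := hA.1.spectral_theorem
  let s : Equiv.Perm (Fin T) := Tuple.sort fun i => - lam i
  have hs : Monotone ((fun i => - lam i) ∘ s) := Tuple.monotone_sort _
  let γ : Fin T → ℝ := fun i => √(lam (s i))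
  have hlam : ∀ i, 0 < lam i := fun i => hA.eigenvalues_pos i
  have hγ : ∀ i, 0 < γ i := fun i => Real.sqrt_pos.2 (hlam _)
  let U : Matrix (Fin T) (Fin T) ℝ := V.submatrix id s
  have hUU : Uᵀ * U = 1 := by
    have : Uᵀ * U = (Vᵀ * V).submatrix s s := by
      ext i j; simp [U, Matrix.mul_apply]
    rw [this, hVV, Matrix.submatrix_one_equiv]
  have hUU' : U * Uᵀ = 1 := mul_eq_one_comm.1 hUU
  have hd : Matrix.diagonal γ * Matrix.diagonal (fun i => (γ i)⁻¹) = 1 := by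
    rw [Matrix.diagonal_mul_diagonal, ← Matrix.diagonal_one]
    congr 1; ext i; exact mul_inv_cancel₀ (hγ i).ne'
  have hUA : Uᵀ * (A * Aᵀ) * U = Matrix.diagonal (fun i => γ i * γ i) := by
    have h1 : Vᵀ * (A * Aᵀ) * V = Matrix.diagonal lam := by
      rw [hsp]
      calc Vᵀ * (V * Matrix.diagonal lam * Vᵀ) * V
          = (Vᵀ * V) * Matrix.diagonal lam * (Vᵀ * V) := by simp only [Matrix.mul_assoc]
        _ = _ := by rw [hVV, Matrix.one_mul, Matrix.mul_one]
    have h2 : Uᵀ * (A * Aᵀ) * U = (Vᵀ * (A * Aᵀ) * V).submatrix s s := by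
      ext i j; simp only [U, Matrix.mul_apply, Matrix.submatrix_apply, Matrix.transpose_apply, id]
    rw [h2, h1, Matrix.submatrix_diagonal_equiv]
    congr 1; ext i
    exact (Real.mul_self_sqrt (hlam _).le).symm
  refine ⟨⟨U, γ, Matrix.diagonal (fun i => (γ i)⁻¹) * Uᵀ * A, hUU, ?_, hγ, ?_, ?_⟩⟩
  · rw [Matrix.transpose_mul, Matrix.transpose_mul, Matrix.transpose_transpose,
      Matrix.diagonal_transpose]
    calc Matrix.diagonal (fun i => (γ i)⁻¹) * Uᵀ * A *
          (Aᵀ * (U * Matrix.diagonal (fun i => (γ i)⁻¹)))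
        = Matrix.diagonal (fun i => (γ i)⁻¹) * (Uᵀ * (A * Aᵀ) * U) *
            Matrix.diagonal (fun i => (γ i)⁻¹) := by simp only [Matrix.mul_assoc]
      _ = 1 := by
        rw [hUA, Matrix.diagonal_mul_diagonal, Matrix.diagonal_mul_diagonal, ← Matrix.diagonal_one]
        congr 1; ext i
        have := (hγ i).ne'
        field_simp
  · intro i j hij
    exact Real.sqrt_le_sqrt (neg_le_neg_iff.1 (hs hij))
  · calc A = U * Uᵀ * A := by rw [hUU', Matrix.one_mul]
      _ = U * (Matrix.diagonal γ * Matrix.diagonal (fun i => (γ i)⁻¹)) * Uᵀ * A := by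
        rw [hd, Matrix.mul_one]
      _ = _ := by simp only [Matrix.mul_assoc]

/-- `O_u S` has such a decomposition when all `u_t` are non-zero. -/
theorem svd_nonempty {T n : ℕ} (u : Fin T → EuclideanSpace ℝ (Fin n)) (hu : ∀ t, u t ≠ 0) :
    Nonempty (SVD (obsMat u * sumMat T n)) := by
  refine SVD.nonempty_of_posDef ?_
  have key : Function.Injective fun v => v ᵥ* (obsMat u * sumMat T n) := by
    refine (injective_iff_map_eq_zero (Matrix.vecMulLinear (obsMat u * sumMat T n))).2 ?_
    intro v hv
    rw [Matrix.vecMulLinear_apply, ← Matrix.vecMul_vecMul] at hv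
    have hO : ∀ b, (v ᵥ* obsMat u) b = v b.1 * u b.1 b.2 := by
      intro b
      simp [Matrix.vecMul, dotProduct, obsMat]
    have hw : ∀ s j, ∑ t ∈ Finset.Ici s, v t * u t j = 0 := by
      intro s j
      have := congrFun hv (s, j)
      simp only [Matrix.vecMul, dotProduct, sumMat, Matrix.of_apply, Fintype.sum_prod_type,
        mul_ite, mul_one, mul_zero, ite_and, Pi.zero_apply] at this
      rw [← this, ← Finset.sum_filter_add_sum_filter_not Finset.univ (fun i : Fin T => s ≤ i)]
      rw [Finset.sum_eq_zero (s := Finset.univ.filter fun i : Fin T => ¬ s ≤ i), add_zero]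
      · refine Finset.sum_congr (by ext; simp) fun i hi => ?_
        have h2 : s ≤ i := (Finset.mem_filter.1 hi).2
        have := hO (i, j)
        simp only [Matrix.vecMul, dotProduct] at this
        simp [h2, this]
      · intro i hi
        have : ¬ s ≤ i := (Finset.mem_filter.1 hi).2
        simp [this]
    have h0 : ∀ s j, v s * u s j = 0 := by
      intro s
      induction s using WellFoundedGT.induction with
      | ind s ih =>
        intro j
        have := hw s j
        rwa [← Finset.Ioi_insert, Finset.sum_insert (by simp),
          Finset.sum_eq_zero (fun t ht => ih t (Finset.mem_Ioi.1 ht) j), add_zero] at this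
    ext s
    by_contra hs
    exact hu s (by ext j; simpa using (mul_eq_zero.1 (h0 s j)).resolve_left hs)
  exact Matrix.PosDef.mul_conjTranspose_self _ key

/-- The Hilbert-Schmidt (Frobenius) norm. -/
def hsNorm {m k : Type*} [Fintype m] [Fintype k] (A : Matrix m k ℝ) : ℝ :=
  √(∑ i, ∑ j, A i j ^ 2)

/-- The Euclidean norm of a finite real vector. -/
def vecNorm {k : Type*} [Fintype k] (v : k → ℝ) : ℝ :=
  ‖(WithLp.toLp 2 v : EuclideanSpace ℝ k)‖

variable {Ω : Type*} [MeasurableSpace Ω]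

/-- `X ∼ SG(κ)`, for a centered random variable `X`. -/
def IsSG (X : Ω → ℝ) (κ : ℝ) (μ : Measure Ω) : Prop :=
  ∀ t : ℝ, 0 < t → μ.real {ω | t < |X ω|} ≤ 2 * Real.exp (-(t ^ 2 / κ ^ 2))

/-- `X ∼ ISG(σ, κ)`: independent centered coordinates with second moment `σ²`, each `SG(κ)`. -/
structure IsISG {k : Type*} (X : Ω → k → ℝ) (σ κ : ℝ) (μ : Measure Ω) : Prop where
  measurable : ∀ i, Measurable fun ω => X ω i
  indep : iIndepFun (fun i ω => X ω i) μ
  mean : ∀ i, ∫ ω, X ω i ∂μ = 0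
  second_moment : ∀ i, ∫ ω, X ω i ^ 2 ∂μ = σ ^ 2
  subGaussian : ∀ i, IsSG (fun ω => X ω i) κ μ

end

end VarEst

namespace VarEst

/-! ### Exponential moments of one sub-Gaussian variable and of its square. -/

section SubgaussianVariable

/-! Put `A = O_u S`. Since `A = U Diag(γ) W`, the product `R' A` is an orthogonal projection of rank
`p`, and `R' Y = R' A h + R' z = Wᵀ G (h, z)` with `G = truncFactor`. As `Wᵀ` is an isometry, `‖R'
Y‖²` is the quadratic form of `Gᵀ G` in the independent centered coordinates of `(h, z)`. Its
diagonal gives the mean `p σ² + ‖R'‖² η²`.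

The fluctuation is controlled by the Hilbert-Schmidt norm of `Gᵀ G`, which equals that of `G Gᵀ`, a
diagonal matrix with `p` nonzero entries `1 + γ_i⁻²`. The bound `γ_i⁻² ≤ 4 ‖u_min‖⁻²`, uniform in
`T`, holds because `S⁻¹` is a difference operator of norm at most 2 (`SVD.inv_sq_le`). Hence the
norm is at most `√p (1 + 4 ‖u_min‖⁻²)`, and division by `p` leaves the rate `1/√p`.

The probabilistic input is a weak Hanson-Wright inequality
(`IsCenteredSG.measureReal_quadraticForm_le`): deviations of order `κ² F log(1/δ)`, where `F` bounds
the Hilbert-Schmidt norm. Only a purely exponential tail is needed, so it suffices to bound one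
exponential moment by 3 at parameter of order `1/(κ² F)`. The diagonal part factors by independence;
the off-diagonal part is decoupled by averaging over subsets of the indices. -/

theorem exp_le_add_exp_sq (x : ℝ) : Real.exp x ≤ x + Real.exp (x ^ 2) := by
  have h1 := Real.add_one_le_exp (x ^ 2)
  by_cases hx : |x| ≤ 1
  · have := (abs_le.1 (Real.abs_exp_sub_one_sub_id_le hx)).2
    linarith
  · rcases lt_abs.1 (not_le.1 hx) with h | h
    · have : Real.exp x ≤ Real.exp (x ^ 2) := Real.exp_le_exp.2 (by nlinarith)
      linarith
    · have : Real.exp x ≤ 1 := Real.exp_le_one_iff.2 (by linarith)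
      nlinarith

theorem exp_mul_le_one_add {θ v : ℝ} (h0 : 0 ≤ θ) (h1 : θ ≤ 1) :
    Real.exp (θ * v) ≤ 1 + θ * (Real.exp v - 1) := by
  have := convexOn_exp.2 (Set.mem_univ v) (Set.mem_univ 0) h0 (sub_nonneg.2 h1) (by ring)
  simp only [smul_eq_mul, mul_zero, add_zero, Real.exp_zero] at this
  linarith

/-- The second-order Taylor remainder is absorbed into `exp v` while keeping the factor `θ²`. With
`v` a multiple of `X²`, this gives a centered square a quadratic log-moment bound. -/
theorem exp_mul_le_quadratic {θ v : ℝ} (hθ : |θ| ≤ 1 / 2) (hv : 0 ≤ v) :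
    Real.exp (θ * v) ≤ 1 + θ * v + 4 * θ ^ 2 * Real.exp v := by
  have hexp : Real.exp (θ * v) - 1 - θ * v ≤ (θ * v) ^ 2 / 2 * Real.exp (|θ| * v) := by
    have key : ∀ x : ℝ, 0 ≤ x → Real.exp x - 1 - x ≤ x ^ 2 / 2 * Real.exp x := by
      intro x hx
      have h2 : (1 - x ^ 2 / 2) * Real.exp x ≤ 1 + x := by
        have hm : AntitoneOn (fun y : ℝ => (1 - y ^ 2 / 2) * Real.exp y - y) (Set.Ici 0) := by
          refine antitoneOn_of_deriv_nonpos (convex_Ici 0) (by fun_prop) (by fun_prop) ?_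
          intro y hy
          rw [interior_Ici] at hy
          have hd : HasDerivAt (fun y : ℝ => (1 - y ^ 2 / 2) * Real.exp y - y)
              ((-y) * Real.exp y + (1 - y ^ 2 / 2) * Real.exp y - 1) y := by
            have h1 : HasDerivAt (fun y : ℝ => 1 - y ^ 2 / 2) (-y) y := by
              exact (((hasDerivAt_pow 2 y).div_const 2).const_sub 1).congr_deriv (by norm_num)
            exact (h1.mul (Real.hasDerivAt_exp y)).sub (hasDerivAt_id y)
          rw [hd.deriv]
          have h3 := Real.one_sub_le_exp_neg y
          have h4 : (1 - y) * Real.exp y ≤ 1 := by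
            calc (1 - y) * Real.exp y ≤ Real.exp (-y) * Real.exp y := by gcongr
              _ = 1 := by rw [← Real.exp_add]; simp
          nlinarith [Real.exp_pos y, sq_nonneg y, mul_nonneg (sq_nonneg y) (Real.exp_pos y).le]
        have := hm (Set.mem_Ici.2 le_rfl) (Set.mem_Ici.2 hx) hx
        simp at this
        linarith
      linarith
    rcases le_total 0 θ with h | h
    · rw [abs_of_nonneg h]; exact key _ (mul_nonneg h hv)
    · rw [abs_of_nonpos h]
      have hx : 0 ≤ -θ * v := mul_nonneg (neg_nonneg.2 h) hv
      have h1 := Real.quadratic_le_exp_of_nonneg hx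
      have h2 : Real.exp (θ * v) = (Real.exp (-θ * v))⁻¹ := by rw [← Real.exp_neg]; ring_nf
      have h3 : Real.exp (θ * v) ≤ 1 + θ * v + (θ * v) ^ 2 / 2 := by
        set x := -θ * v with hxd
        have e1 : θ * v = -x := by rw [hxd]; ring
        rw [h2, inv_le_iff_one_le_mul₀ (Real.exp_pos _), e1]
        have : 0 ≤ 1 + -x + (-x) ^ 2 / 2 := by nlinarith [sq_nonneg (x - 1)]
        -- The product equals `1 + x⁴/4`.
        calc (1 : ℝ) ≤ (1 + -x + (-x) ^ 2 / 2) * (1 + x + x ^ 2 / 2) := by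
              nlinarith [sq_nonneg (x ^ 2)]
          _ ≤ _ := by gcongr
      have h4 : 1 ≤ Real.exp (-θ * v) := Real.one_le_exp hx
      nlinarith [sq_nonneg (θ * v)]
  have h1 : v ^ 2 / 8 ≤ Real.exp (v / 2) := by
    have := Real.quadratic_le_exp_of_nonneg (x := v / 2) (by linarith)
    nlinarith
  have h2 : Real.exp (|θ| * v) ≤ Real.exp (v / 2) := Real.exp_le_exp.2 (by nlinarith)
  have h3 : Real.exp v = Real.exp (v / 2) * Real.exp (v / 2) := by
    rw [← Real.exp_add]; ring_nf
  have h4 : v ^ 2 / 8 * Real.exp (|θ| * v) ≤ Real.exp v := by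
    rw [h3]; gcongr
  nlinarith [sq_nonneg θ, mul_le_mul_of_nonneg_left h4 (sq_nonneg θ)]

variable {Ω : Type*} [MeasurableSpace Ω] {μ : Measure Ω}

/-- Layer-cake formula: levels in `(0, 1]` contribute at most 1, and above 1 the tail hypothesis
gives `2 t⁻²`, of integral 2. -/
theorem IsSG.lintegral_exp_sq_le [IsProbabilityMeasure μ] {X : Ω → ℝ} {κ : ℝ}
    (h : IsSG X κ μ) (hκ : 0 < κ) (hX : Measurable X) :
    ∫⁻ ω, ENNReal.ofReal (Real.exp (X ω ^ 2 / (2 * κ ^ 2))) ∂μ ≤ 3 := by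
  rw [lintegral_eq_lintegral_meas_lt μ (Filter.Eventually.of_forall fun ω => (Real.exp_pos _).le)
    (by fun_prop)]
  rw [← Set.Ioc_union_Ioi_eq_Ioi zero_le_one,
    lintegral_union measurableSet_Ioi (Set.Ioc_disjoint_Ioi le_rfl)]
  have h1 : ∫⁻ t in Set.Ioc (0 : ℝ) 1, μ {a | t < Real.exp (X a ^ 2 / (2 * κ ^ 2))} ≤ 1 := by
    calc _ ≤ ∫⁻ t in Set.Ioc (0 : ℝ) 1, 1 := lintegral_mono fun _ => prob_le_one
      _ = 1 := by simp
  have h2 : ∫⁻ t in Set.Ioi (1 : ℝ), μ {a | t < Real.exp (X a ^ 2 / (2 * κ ^ 2))} ≤ 2 := by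
    calc _ ≤ ∫⁻ t in Set.Ioi (1 : ℝ), ENNReal.ofReal (2 * t ^ (-2 : ℝ)) := by
          refine setLIntegral_mono (by fun_prop) fun t ht => ?_
          have ht1 : (1 : ℝ) < t := ht
          have hlog : 0 < Real.log t := Real.log_pos ht1
          have hsub : {a | t < Real.exp (X a ^ 2 / (2 * κ ^ 2))} ⊆
              {a | √(2 * κ ^ 2 * Real.log t) < |X a|} := by
            intro a ha
            have := (Real.log_lt_iff_lt_exp (by linarith)).2 ha
            rw [lt_div_iff₀ (by positivity)] at this
            change _ < |X a|
            rw [← Real.sqrt_sq_eq_abs]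
            exact Real.sqrt_lt_sqrt (by positivity) (by linarith)
          refine (measure_mono hsub).trans ?_
          rw [← ofReal_measureReal]
          refine ENNReal.ofReal_le_ofReal ((h _ (by positivity)).trans (le_of_eq ?_))
          rw [Real.sq_sqrt (by positivity), Real.rpow_def_of_pos (by linarith)]
          congr 2
          field_simp
      _ = 2 := by
          rw [← ofReal_integral_eq_lintegral_ofReal]
          · rw [integral_const_mul, integral_Ioi_rpow_of_lt (by norm_num) one_pos]
            norm_num
          · exact (integrableOn_Ioi_rpow_of_lt (by norm_num) one_pos).const_mul _
          · refine (ae_restrict_mem measurableSet_Ioi).mono fun t ht => ?_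
            have : (0 : ℝ) < t := one_pos.trans ht
            simp only [Pi.zero_apply]; positivity
  calc _ ≤ (1 : ENNReal) + 2 := add_le_add h1 h2
    _ = 3 := by norm_num

theorem IsSG.integrable_exp_sq [IsProbabilityMeasure μ] {X : Ω → ℝ} {κ : ℝ}
    (h : IsSG X κ μ) (hκ : 0 < κ) (hX : Measurable X) :
    Integrable (fun ω => Real.exp (X ω ^ 2 / (2 * κ ^ 2))) μ := by
  refine ⟨by fun_prop, ?_⟩
  rw [hasFiniteIntegral_iff_ofReal (Filter.Eventually.of_forall fun ω => (Real.exp_pos _).le)]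
  exact (h.lintegral_exp_sq_le hκ hX).trans_lt (by norm_num)

theorem IsSG.integral_exp_sq_le [IsProbabilityMeasure μ] {X : Ω → ℝ} {κ : ℝ}
    (h : IsSG X κ μ) (hκ : 0 < κ) (hX : Measurable X) :
    ∫ ω, Real.exp (X ω ^ 2 / (2 * κ ^ 2)) ∂μ ≤ 3 := by
  have := h.lintegral_exp_sq_le hκ hX
  rw [← ofReal_integral_eq_lintegral_ofReal (h.integrable_exp_sq hκ hX)
    (Filter.Eventually.of_forall fun ω => (Real.exp_pos _).le)] at this
  have h3 : (3 : ENNReal) = ENNReal.ofReal 3 := by norm_num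
  rwa [h3, ENNReal.ofReal_le_ofReal_iff (by norm_num)] at this

theorem mul_le_sq_add_sq_div {t x κ : ℝ} (hκ : 0 < κ) :
    t * x ≤ t ^ 2 * κ ^ 2 / 2 + x ^ 2 / (2 * κ ^ 2) := by
  have h : t * x = (t * κ) * (x / κ) := by field_simp
  have h' : x ^ 2 / (2 * κ ^ 2) = (x / κ) ^ 2 / 2 := by field_simp
  rw [h, h']
  nlinarith [sq_nonneg (t * κ - x / κ)]

theorem IsSG.integrable_exp_mul [IsProbabilityMeasure μ] {X : Ω → ℝ} {κ : ℝ}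
    (h : IsSG X κ μ) (hκ : 0 < κ) (hX : Measurable X) (t : ℝ) :
    Integrable (fun ω => Real.exp (t * X ω)) μ := by
  refine ((h.integrable_exp_sq hκ hX).const_mul (Real.exp (t ^ 2 * κ ^ 2 / 2))).mono'
    (by fun_prop) (Filter.Eventually.of_forall fun ω => ?_)
  rw [Real.norm_of_nonneg (Real.exp_pos _).le, ← Real.exp_add]
  exact Real.exp_le_exp.2 (mul_le_sq_add_sq_div hκ)

theorem IsSG.integrable_sq [IsProbabilityMeasure μ] {X : Ω → ℝ} {κ : ℝ}
    (h : IsSG X κ μ) (hκ : 0 < κ) (hX : Measurable X) : Integrable (fun ω => X ω ^ 2) μ := by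
  refine ((h.integrable_exp_sq hκ hX).const_mul (2 * κ ^ 2)).mono'
    (by fun_prop) (Filter.Eventually.of_forall fun ω => ?_)
  rw [Real.norm_of_nonneg (sq_nonneg _), ← div_le_iff₀' (by positivity)]
  linarith [Real.add_one_le_exp (X ω ^ 2 / (2 * κ ^ 2))]

theorem IsSG.integrable [IsProbabilityMeasure μ] {X : Ω → ℝ} {κ : ℝ}
    (h : IsSG X κ μ) (hκ : 0 < κ) (hX : Measurable X) : Integrable X μ := by
  refine ((h.integrable_sq hκ hX).add (integrable_const 1)).mono'
    (by fun_prop) (Filter.Eventually.of_forall fun ω => ?_)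
  simp only [Pi.add_apply, Real.norm_eq_abs]
  nlinarith [sq_abs (X ω), sq_nonneg (|X ω| - 1)]

theorem IsSG.hasSubgaussianMGF [IsProbabilityMeasure μ] {X : Ω → ℝ} {κ : ℝ}
    (h : IsSG X κ μ) (hκ : 0 < κ) (hX : Measurable X) (h0 : ∫ ω, X ω ∂μ = 0) :
    HasSubgaussianMGF X (8 * κ ^ 2).toNNReal μ := by
  refine ⟨h.integrable_exp_mul hκ hX, fun t => ?_⟩
  have hI := h.integrable_exp_sq hκ hX
  have hI3 := h.integral_exp_sq_le hκ hX
  rw [Real.coe_toNNReal _ (by positivity), mgf]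
  -- For small `t`, `exp x ≤ x + exp (x²)` lets the zero mean remove the linear term, and convexity
  -- in `θ` gives `1 + 2θ`. For large `t`, Young's inequality loses only a factor 3, which `t² κ² ≥
  -- 1/2` absorbs into the exponent.
  rcases le_total (2 * t ^ 2 * κ ^ 2) 1 with h1 | h1
  · set θ := 2 * t ^ 2 * κ ^ 2 with hθ
    calc ∫ ω, Real.exp (t * X ω) ∂μ
        ≤ ∫ ω, (t * X ω + (1 - θ + θ * Real.exp (X ω ^ 2 / (2 * κ ^ 2)))) ∂μ := by
          refine integral_mono (h.integrable_exp_mul hκ hX t)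
            (((h.integrable hκ hX).const_mul t).add ((integrable_const _).add (hI.const_mul _)))
            fun ω => ?_
          have e1 := exp_le_add_exp_sq (t * X ω)
          have e2 := exp_mul_le_one_add (v := X ω ^ 2 / (2 * κ ^ 2)) (by positivity) h1
          have e3 : (t * X ω) ^ 2 = θ * (X ω ^ 2 / (2 * κ ^ 2)) := by rw [hθ]; field_simp
          rw [e3] at e1
          simp only
          linarith
      _ = 1 - θ + θ * ∫ ω, Real.exp (X ω ^ 2 / (2 * κ ^ 2)) ∂μ := by
          have hA : Integrable (fun ω => 1 - θ + θ * Real.exp (X ω ^ 2 / (2 * κ ^ 2))) μ :=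
            (integrable_const _).add (hI.const_mul _)
          rw [integral_add ((h.integrable hκ hX).const_mul t) hA, integral_const_mul, h0,
            integral_add (integrable_const _) (hI.const_mul _), integral_const_mul]
          simp
      _ ≤ 1 - θ + θ * 3 := by gcongr
      _ ≤ Real.exp (2 * θ) := by linarith [Real.add_one_le_exp (2 * θ)]
      _ = _ := by rw [hθ]; ring_nf
  · have h3 : (3 : ℝ) ≤ Real.exp (7 / 2 * t ^ 2 * κ ^ 2) := by
      have : (3 : ℝ) ≤ Real.exp (7 / 4) := by
        have := Real.quadratic_le_exp_of_nonneg (x := 7 / 4) (by norm_num)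
        norm_num at this ⊢; linarith
      refine this.trans (Real.exp_le_exp.2 (by linarith))
    calc ∫ ω, Real.exp (t * X ω) ∂μ
        ≤ ∫ ω, Real.exp (t ^ 2 * κ ^ 2 / 2) * Real.exp (X ω ^ 2 / (2 * κ ^ 2)) ∂μ := by
          refine integral_mono (h.integrable_exp_mul hκ hX t) (hI.const_mul _) fun ω => ?_
          rw [← Real.exp_add]
          exact Real.exp_le_exp.2 (mul_le_sq_add_sq_div hκ)
      _ ≤ Real.exp (t ^ 2 * κ ^ 2 / 2) * 3 := by rw [integral_const_mul]; gcongr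
      _ ≤ Real.exp (t ^ 2 * κ ^ 2 / 2) * Real.exp (7 / 2 * t ^ 2 * κ ^ 2) := by gcongr
      _ = _ := by rw [← Real.exp_add]; ring_nf

/-- The shift by the mean cancels the first-order term of the expansion in `θ`; the remainder is `4
(2κ²θ)²` times an exponential moment at most 3, whence 48. -/
theorem IsSG.lintegral_exp_centered_sq_le [IsProbabilityMeasure μ] {X : Ω → ℝ} {κ θ : ℝ}
    (h : IsSG X κ μ) (hκ : 0 < κ) (hX : Measurable X) (hθ : |θ| * (2 * κ ^ 2) ≤ 1 / 2) :
    ∫⁻ ω, ENNReal.ofReal (Real.exp (θ * (X ω ^ 2 - ∫ ω', X ω' ^ 2 ∂μ))) ∂μ ≤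
      ENNReal.ofReal (Real.exp (48 * κ ^ 4 * θ ^ 2)) := by
  have hI := h.integrable_exp_sq hκ hX
  have hI3 := h.integral_exp_sq_le hκ hX
  have hS := h.integrable_sq hκ hX
  set m := ∫ ω', X ω' ^ 2 ∂μ with hm
  have hA : Integrable (fun ω => 1 + θ * X ω ^ 2) μ := (integrable_const _).add (hS.const_mul _)
  have hJ : Integrable (fun ω => 1 + θ * X ω ^ 2 +
      16 * κ ^ 4 * θ ^ 2 * Real.exp (X ω ^ 2 / (2 * κ ^ 2))) μ :=
    hA.add (hI.const_mul _)
  have hpt : ∀ ω, Real.exp (θ * (X ω ^ 2 - m)) ≤ Real.exp (-(θ * m)) * (1 + θ * X ω ^ 2 +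
      16 * κ ^ 4 * θ ^ 2 * Real.exp (X ω ^ 2 / (2 * κ ^ 2))) := by
    intro ω
    have := exp_mul_le_quadratic (θ := θ * (2 * κ ^ 2)) (v := X ω ^ 2 / (2 * κ ^ 2))
      (by rwa [abs_mul, abs_of_nonneg (by positivity : 0 ≤ 2 * κ ^ 2)]) (by positivity)
    have e : θ * (2 * κ ^ 2) * (X ω ^ 2 / (2 * κ ^ 2)) = θ * X ω ^ 2 := by field_simp
    rw [e] at this
    have e2 : θ * (X ω ^ 2 - m) = -(θ * m) + θ * X ω ^ 2 := by ring
    rw [e2, Real.exp_add]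
    gcongr
    linarith
  have hnn : ∀ ω, 0 ≤ Real.exp (-(θ * m)) * (1 + θ * X ω ^ 2 +
      16 * κ ^ 4 * θ ^ 2 * Real.exp (X ω ^ 2 / (2 * κ ^ 2))) :=
    fun ω => (Real.exp_pos _).le.trans (hpt ω)
  calc _ ≤ ∫⁻ ω, ENNReal.ofReal (Real.exp (-(θ * m)) * (1 + θ * X ω ^ 2 +
      16 * κ ^ 4 * θ ^ 2 * Real.exp (X ω ^ 2 / (2 * κ ^ 2)))) ∂μ :=
        lintegral_mono fun ω => ENNReal.ofReal_le_ofReal (hpt ω)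
    _ = ENNReal.ofReal (Real.exp (-(θ * m)) * (1 + θ * m +
      16 * κ ^ 4 * θ ^ 2 * ∫ ω, Real.exp (X ω ^ 2 / (2 * κ ^ 2)) ∂μ)) := by
        rw [← ofReal_integral_eq_lintegral_ofReal (hJ.const_mul _)
          (Filter.Eventually.of_forall hnn), integral_const_mul,
          integral_add hA (hI.const_mul _),
          integral_add (integrable_const _) (hS.const_mul _), integral_const_mul,
          integral_const_mul]
        simp [hm]
    _ ≤ _ := by
        refine ENNReal.ofReal_le_ofReal ?_
        calc _ ≤ Real.exp (-(θ * m)) * (1 + θ * m + 16 * κ ^ 4 * θ ^ 2 * 3) := by gcongr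
          _ ≤ Real.exp (-(θ * m)) * Real.exp (θ * m + 48 * κ ^ 4 * θ ^ 2) := by
            gcongr
            linarith [Real.add_one_le_exp (θ * m + 48 * κ ^ 4 * θ ^ 2)]
          _ = _ := by rw [← Real.exp_add]; ring_nf

end SubgaussianVariable

/-! ### Hanson-Wright inequality at the Hilbert-Schmidt scale. -/

section QuadraticChaos

/-- Independent centered coordinates, each `SG(κ)`, with no condition on the second moments. -/
structure IsCenteredSG {Ω : Type*} [MeasurableSpace Ω] {k : Type*} (X : Ω → k → ℝ) (κ : ℝ)
    (μ : Measure Ω) : Prop where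
  measurable : ∀ i, Measurable fun ω => X ω i
  indep : iIndepFun (fun i ω => X ω i) μ
  mean : ∀ i, ∫ ω, X ω i ∂μ = 0
  subGaussian : ∀ i, IsSG (fun ω => X ω i) κ μ

variable {Ω : Type*} [MeasurableSpace Ω] {μ : Measure Ω}
variable {ι : Type*} {X : Ω → ι → ℝ} {κ : ℝ}

theorem lintegral_exp_le_of_hasSubgaussianMGF {Y : Ω → ℝ} {c : NNReal}
    (h : HasSubgaussianMGF Y c μ) :
    ∫⁻ ω, ENNReal.ofReal (Real.exp (Y ω)) ∂μ ≤ ENNReal.ofReal (Real.exp (c / 2)) := by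
  have hi : Integrable (fun ω => Real.exp (Y ω)) μ := by simpa using h.integrable_exp_mul 1
  rw [← ofReal_integral_eq_lintegral_ofReal hi
    (Filter.Eventually.of_forall fun ω => (Real.exp_pos _).le)]
  exact ENNReal.ofReal_le_ofReal (by simpa [mgf] using h.mgf_le 1)

theorem hasSubgaussianMGF_mono {Y : Ω → ℝ} {c d : NNReal} (h : HasSubgaussianMGF Y c μ)
    (hcd : c ≤ d) : HasSubgaussianMGF Y d μ :=
  ⟨h.integrable_exp_mul, fun t => (h.mgf_le t).trans (Real.exp_le_exp.2 (by gcongr))⟩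

/-- Jensen's inequality for `exp`. It needs no independence between the `v i`, so it serves both for
correlated squares and for averaging over index subsets. -/
theorem lintegral_exp_weighted_sum_le {s : Finset ι} {w : ι → ℝ} {v : Ω → ι → ℝ} {M : ENNReal}
    (hw : ∀ i ∈ s, 0 ≤ w i) (hw1 : ∑ i ∈ s, w i = 1) (hv : ∀ i ∈ s, Measurable fun ω => v ω i)
    (hM : ∀ i ∈ s, ∫⁻ ω, ENNReal.ofReal (Real.exp (v ω i)) ∂μ ≤ M) :
    ∫⁻ ω, ENNReal.ofReal (Real.exp (∑ i ∈ s, w i * v ω i)) ∂μ ≤ M := by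
  calc ∫⁻ ω, ENNReal.ofReal (Real.exp (∑ i ∈ s, w i * v ω i)) ∂μ
      ≤ ∫⁻ ω, ∑ i ∈ s, ENNReal.ofReal (w i) * ENNReal.ofReal (Real.exp (v ω i)) ∂μ := by
        refine lintegral_mono fun ω => ?_
        have := convexOn_exp.map_sum_le (p := v ω) hw hw1 fun _ _ => Set.mem_univ _
        simp only [smul_eq_mul] at this
        refine (ENNReal.ofReal_le_ofReal this).trans ?_
        rw [ENNReal.ofReal_sum_of_nonneg fun i hi => mul_nonneg (hw i hi) (Real.exp_pos _).le]
        exact Finset.sum_le_sum fun i hi => (ENNReal.ofReal_mul (hw i hi)).le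
    _ = ∑ i ∈ s, ENNReal.ofReal (w i) * ∫⁻ ω, ENNReal.ofReal (Real.exp (v ω i)) ∂μ := by
        have hm : ∀ i ∈ s, Measurable fun ω => ENNReal.ofReal (Real.exp (v ω i)) := fun i hi =>
          (Real.measurable_exp.comp (hv i hi)).ennreal_ofReal
        rw [lintegral_finsetSum' s fun i hi => ((hm i hi).const_mul _).aemeasurable]
        exact Finset.sum_congr rfl fun i hi => lintegral_const_mul _ (hm i hi)
    _ ≤ ∑ i ∈ s, ENNReal.ofReal (w i) * M :=
        Finset.sum_le_sum fun i hi => mul_le_mul_right (hM i hi) _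
    _ = M := by
        rw [← Finset.sum_mul, ← ENNReal.ofReal_sum_of_nonneg hw, hw1, ENNReal.ofReal_one, one_mul]

theorem measureReal_le_of_lintegral_exp_le {f : Ω → ℝ} (hf : Measurable f)
    (h : ∫⁻ ω, ENNReal.ofReal (Real.exp (f ω)) ∂μ ≤ 3) (x : ℝ) :
    μ.real {ω | x ≤ f ω} ≤ 3 * Real.exp (-x) := by
  have h1 := mul_meas_ge_le_lintegral (μ := μ) (f := fun ω => ENNReal.ofReal (Real.exp (f ω)))
    (by fun_prop) (ENNReal.ofReal (Real.exp x))
  have h2 : {ω | ENNReal.ofReal (Real.exp x) ≤ ENNReal.ofReal (Real.exp (f ω))} =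
      {ω | x ≤ f ω} := by
    ext ω
    change ENNReal.ofReal _ ≤ ENNReal.ofReal _ ↔ x ≤ f ω
    rw [ENNReal.ofReal_le_ofReal_iff (Real.exp_pos _).le, Real.exp_le_exp]
  rw [h2] at h1
  have h3 := ENNReal.toReal_mono (by norm_num) (h1.trans h)
  rw [ENNReal.toReal_mul, ENNReal.toReal_ofReal (Real.exp_pos _).le] at h3
  rw [Real.exp_neg, ← div_eq_mul_inv, le_div_iff₀' (Real.exp_pos x)]
  exact h3

variable [IsProbabilityMeasure μ]

theorem isSG_of_hasSubgaussianMGF {Y : Ω → ℝ} {c : NNReal} {κ : ℝ}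
    (h : HasSubgaussianMGF Y c μ) (hκ : κ ^ 2 = 2 * c) : IsSG Y κ μ := by
  intro t ht
  have hsub : {ω | t < |Y ω|} ⊆ {ω | t ≤ Y ω} ∪ {ω | t ≤ (-Y) ω} := by
    intro ω hω
    rcases lt_abs.1 (show t < |Y ω| from hω) with h | h
    · exact Or.inl h.le
    · exact Or.inr h.le
  calc μ.real {ω | t < |Y ω|} ≤ μ.real {ω | t ≤ Y ω} + μ.real {ω | t ≤ (-Y) ω} :=
        (measureReal_mono hsub).trans (measureReal_union_le _ _)
    _ ≤ Real.exp (-t ^ 2 / (2 * c)) + Real.exp (-t ^ 2 / (2 * c)) :=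
        add_le_add (h.measure_ge_le ht.le) (h.neg.measure_ge_le ht.le)
    _ = _ := by rw [hκ, neg_div]; ring

theorem IsCenteredSG.hasSubgaussianMGF_linear (h : IsCenteredSG X κ μ) (hκ : 0 < κ) (s : Finset ι)
    (a : ι → ℝ) : HasSubgaussianMGF (fun ω => ∑ i ∈ s, a i * X ω i)
      (8 * κ ^ 2 * ∑ i ∈ s, a i ^ 2).toNNReal μ := by
  have h1 : iIndepFun (fun i ω => a i * X ω i) μ :=
    h.indep.comp (fun i x => a i * x) fun i => by fun_prop
  have h2 : ∀ i, HasSubgaussianMGF (fun ω => a i * X ω i) (8 * κ ^ 2 * a i ^ 2).toNNReal μ := by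
    intro i
    have h0 := (h.subGaussian i).hasSubgaussianMGF hκ (h.measurable i) (h.mean i)
    refine ⟨fun t => by simpa only [mul_assoc] using h0.integrable_exp_mul (t * a i), fun t => ?_⟩
    have h3 := h0.mgf_le (t * a i)
    rw [Real.coe_toNNReal _ (by positivity)] at h3 ⊢
    simp only [mgf, mul_assoc] at h3 ⊢
    exact h3.trans (le_of_eq (by ring_nf))
  have h3 := HasSubgaussianMGF.sum_of_iIndepFun h1 (s := s) fun i _ => h2 i
  rwa [Finset.mul_sum, Real.toNNReal_sum_of_nonneg fun i _ => by positivity]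

theorem IsCenteredSG.lintegral_exp_linear_le (h : IsCenteredSG X κ μ) (hκ : 0 < κ) (s : Finset ι)
    (a : ι → ℝ) : ∫⁻ ω, ENNReal.ofReal (Real.exp (∑ i ∈ s, a i * X ω i)) ∂μ ≤
      ENNReal.ofReal (Real.exp (4 * κ ^ 2 * ∑ i ∈ s, a i ^ 2)) := by
  refine (lintegral_exp_le_of_hasSubgaussianMGF (h.hasSubgaussianMGF_linear hκ s a)).trans ?_
  rw [Real.coe_toNNReal _ (by positivity)]
  exact le_of_eq (by ring_nf)

/-- A linear form is again sub-Gaussian, with squared tail parameter `16 κ² A`, so the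
square-exponential bound applies to it. -/
theorem IsCenteredSG.lintegral_exp_linear_sq_le (h : IsCenteredSG X κ μ) (hκ : 0 < κ)
    (s : Finset ι) (a : ι → ℝ) {A τ : ℝ} (hA : 0 < A) (ha : ∑ i ∈ s, a i ^ 2 ≤ A)
    (hτ : τ * (32 * κ ^ 2 * A) ≤ 1) :
    ∫⁻ ω, ENNReal.ofReal (Real.exp (τ * (∑ i ∈ s, a i * X ω i) ^ 2)) ∂μ ≤ 3 := by
  have h1 : HasSubgaussianMGF (fun ω => ∑ i ∈ s, a i * X ω i) (8 * κ ^ 2 * A).toNNReal μ :=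
    hasSubgaussianMGF_mono (h.hasSubgaussianMGF_linear hκ s a)
      (Real.toNNReal_le_toNNReal (by gcongr))
  have hk : √(16 * κ ^ 2 * A) ^ 2 = 16 * κ ^ 2 * A := Real.sq_sqrt (by positivity)
  have h2 : IsSG (fun ω => ∑ i ∈ s, a i * X ω i) √(16 * κ ^ 2 * A) μ := by
    refine isSG_of_hasSubgaussianMGF h1 ?_
    rw [hk, Real.coe_toNNReal _ (by positivity)]; ring
  have hm : Measurable fun ω => ∑ i ∈ s, a i * X ω i :=
    Finset.measurable_sum _ fun i _ => (h.measurable i).const_mul _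
  refine le_trans (lintegral_mono fun ω => ?_)
    (h2.lintegral_exp_sq_le (Real.sqrt_pos.2 (by positivity)) hm)
  refine ENNReal.ofReal_le_ofReal (Real.exp_le_exp.2 ?_)
  rw [hk, le_div_iff₀ (by positivity)]
  nlinarith [sq_nonneg (∑ i ∈ s, a i * X ω i)]

/-- The linear forms are dependent, so Jensen is used with weights proportional to their squared
coefficient norms; the resulting constant does not depend on the number of forms. -/
theorem IsCenteredSG.lintegral_exp_sum_sq_le (h : IsCenteredSG X κ μ) (hκ : 0 < κ)
    (I J : Finset ι) (q : ι → ι → ℝ) {F τ : ℝ} (hF : 0 < F) (hτ0 : 0 ≤ τ)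
    (hq : ∑ j ∈ J, ∑ i ∈ I, q i j ^ 2 ≤ F ^ 2) (hτ : τ * (64 * κ ^ 2 * F ^ 2) ≤ 1) :
    ∫⁻ ω, ENNReal.ofReal (Real.exp (τ * ∑ j ∈ J, (∑ i ∈ I, q i j * X ω i) ^ 2)) ∂μ ≤ 3 := by
  rcases J.eq_empty_or_nonempty with rfl | hJ
  · simp
  have hc : (0 : ℝ) < J.card := by exact_mod_cast hJ.card_pos
  -- The extra `F² / |J|` keeps every weight positive and at most doubles the total mass, turning 32
  -- into 64.
  set m : ι → ℝ := fun j => ∑ i ∈ I, q i j ^ 2 + F ^ 2 / J.card with hm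
  have hmpos : ∀ j, 0 < m j := fun j =>
    add_pos_of_nonneg_of_pos (Finset.sum_nonneg fun _ _ => sq_nonneg _) (by positivity)
  set W := ∑ j ∈ J, m j with hW
  have hWpos : 0 < W := Finset.sum_pos (fun j _ => hmpos j) hJ
  have hWle : W ≤ 2 * F ^ 2 := by
    rw [hW, hm, Finset.sum_add_distrib, Finset.sum_const, nsmul_eq_mul, mul_div_cancel₀ _ hc.ne']
    linarith
  have hmeas : ∀ j, Measurable fun ω => ∑ i ∈ I, q i j * X ω i := fun j =>
    Finset.measurable_sum _ fun i _ => (h.measurable i).const_mul _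
  have key := lintegral_exp_weighted_sum_le (μ := μ) (s := J) (w := fun j => m j / W)
    (v := fun ω j => τ * W / m j * (∑ i ∈ I, q i j * X ω i) ^ 2) (M := 3)
    (fun j _ => (div_pos (hmpos j) hWpos).le) (by rw [← Finset.sum_div, div_self hWpos.ne'])
    (fun j _ => ((hmeas j).pow_const 2).const_mul _) (fun j _ => by
      refine h.lintegral_exp_linear_sq_le hκ I (fun i => q i j) (hmpos j) ?_ ?_
      · exact le_add_of_nonneg_right (by positivity)
      · have : τ * W / m j * (32 * κ ^ 2 * m j) = τ * (32 * κ ^ 2 * W) := by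
          have := (hmpos j).ne'
          field_simp
        rw [this]
        refine le_trans ?_ hτ
        have : 32 * κ ^ 2 * W ≤ 64 * κ ^ 2 * F ^ 2 := by nlinarith [sq_nonneg κ]
        gcongr)
  refine le_of_eq_of_le ?_ key
  congr 1
  ext ω
  rw [Finset.mul_sum]
  congr 2
  refine Finset.sum_congr rfl fun j _ => ?_
  have := (hmpos j).ne'
  field_simp

/-- Given the coordinates in `I`, the form is linear in the independent coordinates in `J`.
Integrating these out leaves the exponential of a sum of squares of linear forms in the former. -/
theorem IsCenteredSG.lintegral_exp_bilinear_le (h : IsCenteredSG X κ μ) (hκ : 0 < κ)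
    {I J : Finset ι} (hIJ : Disjoint I J) (q : ι → ι → ℝ) {F θ : ℝ} (hF : 0 < F)
    (hq : ∑ j ∈ J, ∑ i ∈ I, q i j ^ 2 ≤ F ^ 2) (hθ : |θ| * (16 * κ ^ 2 * F) ≤ 1) :
    ∫⁻ ω, ENNReal.ofReal (Real.exp (θ * ∑ j ∈ J, (∑ i ∈ I, q i j * X ω i) * X ω j)) ∂μ ≤ 3 := by
  set U : Ω → I → ℝ := fun ω i => X ω i with hU
  set V : Ω → J → ℝ := fun ω j => X ω j with hV
  have hUm : Measurable U := measurable_pi_lambda _ fun i => h.measurable i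
  have hVm : Measurable V := measurable_pi_lambda _ fun j => h.measurable j
  have hUV : IndepFun U V μ := h.indep.indepFun_finset I J hIJ h.measurable
  set f : (I → ℝ) × (J → ℝ) → ENNReal := fun p =>
    ENNReal.ofReal (Real.exp (∑ j : J, (θ * ∑ i : I, q i j * p.1 i) * p.2 j)) with hf
  have hfm : Measurable f := by fun_prop
  have hsumU : ∀ (ω : Ω) (j : ι), ∑ i : I, q i j * U ω i = ∑ i ∈ I, q i j * X ω i := fun ω j =>
    Finset.sum_coe_sort I fun i => q i j * X ω i
  have e1 : ∀ ω, ENNReal.ofReal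
      (Real.exp (θ * ∑ j ∈ J, (∑ i ∈ I, q i j * X ω i) * X ω j)) = f (U ω, V ω) := by
    intro ω
    simp only [hf, hsumU]
    rw [Finset.mul_sum, ← Finset.sum_coe_sort J]
    simp only [mul_assoc, hV]
  simp_rw [e1]
  rw [← lintegral_map (f := f) (g := fun ω => (U ω, V ω)) hfm (hUm.prodMk hVm),
    hUV.map_prod_eq_prod_map_map hUm.aemeasurable hVm.aemeasurable,
    lintegral_prod _ hfm.aemeasurable]
  have inner : ∀ u : I → ℝ, ∫⁻ v, f (u, v) ∂(μ.map V) ≤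
      ENNReal.ofReal (Real.exp (4 * κ ^ 2 * θ ^ 2 * ∑ j ∈ J, (∑ i : I, q i j * u i) ^ 2)) := by
    intro u
    rw [lintegral_map (by fun_prop) hVm]
    have := h.lintegral_exp_linear_le hκ J fun j => θ * ∑ i : I, q i j * u i
    refine le_of_eq_of_le (lintegral_congr fun ω => ?_) (this.trans (le_of_eq ?_))
    · simp only [hf, hV]
      rw [Finset.sum_coe_sort J fun j => (θ * ∑ i : I, q i j * u i) * X ω j]
    · simp only [mul_pow, ← Finset.mul_sum, mul_assoc]
  refine (lintegral_mono inner).trans ?_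
  rw [lintegral_map (by fun_prop) hUm]
  simp_rw [hsumU]
  refine h.lintegral_exp_sum_sq_le hκ I J q hF (by positivity) hq ?_
  have : 4 * κ ^ 2 * θ ^ 2 * (64 * κ ^ 2 * F ^ 2) = (|θ| * (16 * κ ^ 2 * F)) ^ 2 := by
    rw [mul_pow, sq_abs]; ring
  rw [this]
  exact pow_le_one₀ (by positivity) hθ

/-- Each ordered pair of distinct indices is separated by a quarter of all subsets; erasing `i`
identifies these with the subsets avoiding both. -/
theorem four_mul_card_separating [Fintype ι] [DecidableEq ι] {i j : ι} (hij : i ≠ j) :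
    4 * (Finset.univ.filter fun I : Finset ι => i ∈ I ∧ j ∉ I).card = 2 ^ Fintype.card ι := by
  have h : (Finset.univ.filter fun I : Finset ι => i ∈ I ∧ j ∉ I).card =
      (Finset.univ \ {i, j} : Finset ι).powerset.card := by
    refine Finset.card_nbij' (fun I => I.erase i) (fun I => insert i I) ?_ ?_ ?_ ?_
    · intro I hI
      simp only [Finset.coe_filter, Finset.mem_univ, true_and] at hI
      have := hI.2
      simp only [Finset.coe_powerset, Set.mem_preimage, Set.mem_powerset_iff, Finset.coe_subset]
      intro x hx
      simp only [Finset.mem_sdiff, Finset.mem_univ, true_and, Finset.mem_insert,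
        Finset.mem_singleton, not_or]
      grind
    · intro I hI
      have : I ⊆ Finset.univ \ {i, j} := Finset.mem_powerset.1 hI
      simp only [Finset.coe_filter, Finset.mem_univ, true_and]
      refine ⟨by simp, ?_⟩
      have : j ∉ I := fun hj => by simpa using this hj
      grind
    · intro I hI
      exact Finset.insert_erase (Finset.mem_filter.1 hI).2.1
    · intro I hI
      have : I ⊆ Finset.univ \ {i, j} := Finset.mem_powerset.1 hI
      exact Finset.erase_insert fun hi => by simpa using this hi
  have h2 : ({i, j} : Finset ι).card = 2 := Finset.card_pair hij
  have h3 : 2 ≤ Fintype.card ι := h2 ▸ Finset.card_le_univ _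
  rw [h, Finset.card_powerset, Finset.card_sdiff_of_subset (Finset.subset_univ _), h2,
    Finset.card_univ, ← Nat.sub_add_cancel h3]
  simp [pow_add, mul_comm]

theorem sum_separating [Fintype ι] [DecidableEq ι] (a : ι → ι → ℝ) :
    ∑ I : Finset ι, ∑ j ∈ Iᶜ, ∑ i ∈ I, a i j =
      2 ^ Fintype.card ι / 4 * ∑ j, ∑ i ∈ Finset.univ.erase j, a i j := by
  have e : ∀ I : Finset ι, ∑ j ∈ Iᶜ, ∑ i ∈ I, a i j =
      ∑ j, ∑ i, if i ∈ I ∧ j ∉ I then a i j else 0 := by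
    intro I
    rw [← Finset.sum_filter_add_sum_filter_not Finset.univ (fun j => j ∉ I)]
    rw [Finset.sum_eq_zero (s := Finset.univ.filter fun j => ¬ j ∉ I), add_zero]
    · refine Finset.sum_congr (by ext; simp) fun j hj => ?_
      have : j ∉ I := by simpa using hj
      simp [this]
    · intro j hj
      have : j ∈ I := by simpa using hj
      simp [this]
  simp_rw [e]
  rw [Finset.sum_comm, Finset.mul_sum]
  refine Finset.sum_congr rfl fun j _ => ?_
  rw [Finset.sum_comm, Finset.mul_sum, ← Finset.sum_erase (a := j) _ (by simp)]
  refine Finset.sum_congr rfl fun i hi => ?_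
  have := four_mul_card_separating (Finset.ne_of_mem_erase hi)
  rw [← Finset.sum_filter, Finset.sum_const, nsmul_eq_mul]
  have h4 : (4 : ℝ) * (Finset.univ.filter fun I : Finset ι => i ∈ I ∧ j ∉ I).card =
    2 ^ Fintype.card ι := by exact_mod_cast this
  linear_combination a i j / 4 * h4

/-- Decoupling: the off-diagonal sum is 4 times the average over `I` of the bilinear forms between
`I` and its complement. Jensen moves the average outside `exp`; the factor 4 turns 16 into 64. -/
theorem IsCenteredSG.lintegral_exp_offDiag_le [Fintype ι] [DecidableEq ι]
    (h : IsCenteredSG X κ μ) (hκ : 0 < κ)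
    (q : ι → ι → ℝ) {F θ : ℝ} (hF : 0 < F)
    (hq : ∑ i, ∑ j, q i j ^ 2 ≤ F ^ 2) (hθ : |θ| * (64 * κ ^ 2 * F) ≤ 1) :
    ∫⁻ ω, ENNReal.ofReal (Real.exp (θ * ∑ j, ∑ i ∈ Finset.univ.erase j,
      q i j * X ω i * X ω j)) ∂μ ≤ 3 := by
  have key := lintegral_exp_weighted_sum_le (μ := μ) (s := (Finset.univ : Finset (Finset ι)))
    (w := fun _ => 1 / 2 ^ Fintype.card ι)
    (v := fun ω I => 4 * θ * ∑ j ∈ Iᶜ, (∑ i ∈ I, q i j * X ω i) * X ω j) (M := 3)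
    (fun _ _ => by positivity) (by simp) (fun I _ => by
      refine (Finset.measurable_sum _ fun j _ => ?_).const_mul _
      exact (Finset.measurable_sum _ fun i _ => (h.measurable i).const_mul _).mul (h.measurable j))
    (fun I _ => by
      refine h.lintegral_exp_bilinear_le hκ disjoint_compl_right q hF ?_ ?_
      · rw [Finset.sum_comm] at hq
        refine le_trans ?_ hq
        calc _ ≤ ∑ j ∈ Iᶜ, ∑ i, q i j ^ 2 := Finset.sum_le_sum fun j _ =>
              Finset.sum_le_sum_of_subset_of_nonneg (Finset.subset_univ _)
                fun _ _ _ => sq_nonneg _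
          _ ≤ _ := Finset.sum_le_sum_of_subset_of_nonneg (Finset.subset_univ _)
                fun _ _ _ => Finset.sum_nonneg fun _ _ => sq_nonneg _
      · rw [abs_mul, abs_of_pos (by norm_num : (0 : ℝ) < 4)]
        linarith)
  refine le_of_eq_of_le (lintegral_congr fun ω => ?_) key
  have := sum_separating fun i j => q i j * X ω i * X ω j
  congr 2
  simp only [Finset.sum_mul]
  rw [← Finset.mul_sum, ← Finset.mul_sum, this]
  field_simp

/-- Independence factors the integral, and `|q i| ≤ F` puts each factor in the admissible range. The
total exponent is at most `48/64² ≤ 1`, and `e ≤ 3`. -/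
theorem IsCenteredSG.lintegral_exp_diag_le [Fintype ι] (h : IsCenteredSG X κ μ) (hκ : 0 < κ)
    (q : ι → ℝ) {F θ : ℝ} (hF : 0 < F)
    (hq : ∑ i, q i ^ 2 ≤ F ^ 2) (hθ : |θ| * (64 * κ ^ 2 * F) ≤ 1) :
    ∫⁻ ω, ENNReal.ofReal (Real.exp (θ * ∑ i, q i * (X ω i ^ 2 - ∫ ω', X ω' i ^ 2 ∂μ))) ∂μ ≤ 3 := by
  have hqF : ∀ i, |q i| ≤ F := fun i => abs_le_of_sq_le_sq
    ((Finset.single_le_sum (fun j _ => sq_nonneg (q j)) (Finset.mem_univ i)).trans hq) hF.le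
  have h1 : iIndepFun (fun i ω => ENNReal.ofReal
      (Real.exp (θ * q i * (X ω i ^ 2 - ∫ ω', X ω' i ^ 2 ∂μ)))) μ :=
    h.indep.comp (fun i x => ENNReal.ofReal
      (Real.exp (θ * q i * (x ^ 2 - ∫ ω', X ω' i ^ 2 ∂μ)))) fun i => by fun_prop
  have h2 : ∀ i, Measurable fun ω => ENNReal.ofReal
      (Real.exp (θ * q i * (X ω i ^ 2 - ∫ ω', X ω' i ^ 2 ∂μ))) := fun i => by
    have := h.measurable i
    fun_prop
  calc _ = ∫⁻ ω, ∏ i, ENNReal.ofReal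
        (Real.exp (θ * q i * (X ω i ^ 2 - ∫ ω', X ω' i ^ 2 ∂μ))) ∂μ := by
        refine lintegral_congr fun ω => ?_
        rw [← ENNReal.ofReal_prod_of_nonneg fun _ _ => (Real.exp_pos _).le, ← Real.exp_sum,
          Finset.mul_sum]
        simp only [mul_assoc]
    _ = ∏ i, ∫⁻ ω, ENNReal.ofReal
        (Real.exp (θ * q i * (X ω i ^ 2 - ∫ ω', X ω' i ^ 2 ∂μ))) ∂μ :=
        lintegral_prod_eq_prod_lintegral_of_indepFun _ _ h1 h2
    _ ≤ ∏ i, ENNReal.ofReal (Real.exp (48 * κ ^ 4 * (θ * q i) ^ 2)) := by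
        refine Finset.prod_le_prod' fun i _ => ?_
        refine (h.subGaussian i).lintegral_exp_centered_sq_le hκ (h.measurable i) ?_
        rw [abs_mul]
        calc |θ| * |q i| * (2 * κ ^ 2) ≤ |θ| * F * (2 * κ ^ 2) := by gcongr; exact hqF i
          _ ≤ 1 / 2 := by nlinarith [mul_nonneg (mul_nonneg (abs_nonneg θ) hF.le) (sq_nonneg κ)]
    _ = ENNReal.ofReal (Real.exp (48 * κ ^ 4 * θ ^ 2 * ∑ i, q i ^ 2)) := by
        rw [← ENNReal.ofReal_prod_of_nonneg fun _ _ => (Real.exp_pos _).le, ← Real.exp_sum,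
          Finset.mul_sum]
        simp only [mul_pow, mul_assoc]
    _ ≤ ENNReal.ofReal (Real.exp 1) := by
        refine ENNReal.ofReal_le_ofReal (Real.exp_le_exp.2 ?_)
        have h3 : (|θ| * (64 * κ ^ 2 * F)) ^ 2 ≤ 1 := pow_le_one₀ (by positivity) hθ
        rw [mul_pow, sq_abs] at h3
        have h4 : 0 ≤ κ ^ 4 * θ ^ 2 := by positivity
        nlinarith [mul_le_mul_of_nonneg_left hq h4, mul_nonneg h4 (sq_nonneg F)]
    _ ≤ 3 := by
        rw [ENNReal.ofReal_le_iff_le_toReal (by norm_num)]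
        have := Real.exp_one_lt_d9
        norm_num; linarith

/-- A Hanson-Wright inequality at the scale of the Hilbert-Schmidt norm. -/
theorem IsCenteredSG.measureReal_quadraticForm_le [Fintype ι] [DecidableEq ι]
    (h : IsCenteredSG X κ μ) (hκ : 0 < κ) (q : ι → ι → ℝ) {F : ℝ} (hF : 0 < F)
    (hq : ∑ i, ∑ j, q i j ^ 2 ≤ F ^ 2) (L : ℝ) :
    μ.real {ω | 256 * κ ^ 2 * F * L ≤
      |∑ i, ∑ j, q i j * X ω i * X ω j - ∑ i, q i i * ∫ ω', X ω' i ^ 2 ∂μ|} ≤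
      12 * Real.exp (-(2 * L)) := by
  set D : Ω → ℝ := fun ω => ∑ i, q i i * (X ω i ^ 2 - ∫ ω', X ω' i ^ 2 ∂μ) with hD
  set O : Ω → ℝ := fun ω => ∑ j, ∑ i ∈ Finset.univ.erase j, q i j * X ω i * X ω j with hO
  have hDm : Measurable D := Finset.measurable_sum _ fun i _ =>
    (((h.measurable i).pow_const 2).sub_const _).const_mul _
  have hOm : Measurable O := Finset.measurable_sum _ fun j _ => Finset.measurable_sum _ fun i _ =>
    ((h.measurable i).const_mul _).mul (h.measurable j)
  have hsplit : ∀ ω, ∑ i, ∑ j, q i j * X ω i * X ω j - ∑ i, q i i * ∫ ω', X ω' i ^ 2 ∂μ =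
      D ω + O ω := by
    intro ω
    simp only [hD, hO, mul_sub, Finset.sum_sub_distrib]
    rw [Finset.sum_comm, ← Finset.sum_congr rfl fun j _ => Finset.add_sum_erase Finset.univ
      (fun i => q i j * X ω i * X ω j) (Finset.mem_univ j), Finset.sum_add_distrib]
    simp only [pow_two, mul_assoc]
    ring
  have hdiag : ∑ i, q i i ^ 2 ≤ F ^ 2 := le_trans (Finset.sum_le_sum fun i _ =>
    Finset.single_le_sum (f := fun j => q i j ^ 2) (fun _ _ => sq_nonneg _) (Finset.mem_univ i)) hq
  -- The largest admissible parameter; after scaling by it the threshold is `4 L`, so one of `±D`,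
  -- `±O` reaches `2 L`. Four events of probability at most `3 exp(-2L)` give 12.
  set r := 1 / (64 * κ ^ 2 * F) with hr
  have hrpos : 0 < r := by positivity
  have hr1 : |r| * (64 * κ ^ 2 * F) ≤ 1 := by
    rw [abs_of_pos hrpos, hr]; exact le_of_eq (by field_simp)
  have hr2 : |-r| * (64 * κ ^ 2 * F) ≤ 1 := by rwa [abs_neg]
  have hs : r * (256 * κ ^ 2 * F * L) = 4 * L := by rw [hr]; field_simp; ring
  have b1 := measureReal_le_of_lintegral_exp_le (hDm.const_mul r)
    (h.lintegral_exp_diag_le hκ (fun i => q i i) hF hdiag hr1) (2 * L)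
  have b2 := measureReal_le_of_lintegral_exp_le (hDm.const_mul (-r))
    (h.lintegral_exp_diag_le hκ (fun i => q i i) hF hdiag hr2) (2 * L)
  have b3 := measureReal_le_of_lintegral_exp_le (hOm.const_mul r)
    (h.lintegral_exp_offDiag_le hκ q hF hq hr1) (2 * L)
  have b4 := measureReal_le_of_lintegral_exp_le (hOm.const_mul (-r))
    (h.lintegral_exp_offDiag_le hκ q hF hq hr2) (2 * L)
  simp_rw [hsplit]
  have hsub : {ω | 256 * κ ^ 2 * F * L ≤ |D ω + O ω|} ⊆
      ({ω | 2 * L ≤ r * D ω} ∪ {ω | 2 * L ≤ -r * D ω}) ∪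
        ({ω | 2 * L ≤ r * O ω} ∪ {ω | 2 * L ≤ -r * O ω}) := by
    intro ω hω
    have h1 : 4 * L ≤ |r * D ω + r * O ω| := by
      rw [← mul_add, abs_mul, abs_of_pos hrpos, ← hs]
      exact mul_le_mul_of_nonneg_left hω hrpos.le
    by_contra hcon
    simp only [Set.mem_union, Set.mem_ofPred_eq, not_or, not_le] at hcon
    rcases le_abs.1 h1 with h2 | h2 <;> linarith [hcon.1.1, hcon.1.2, hcon.2.1, hcon.2.2]
  calc _ ≤ _ := measureReal_mono hsub
    _ ≤ (μ.real {ω | 2 * L ≤ r * D ω} + μ.real {ω | 2 * L ≤ -r * D ω}) +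
        (μ.real {ω | 2 * L ≤ r * O ω} + μ.real {ω | 2 * L ≤ -r * O ω}) :=
      (measureReal_union_le _ _).trans
        (add_le_add (measureReal_union_le _ _) (measureReal_union_le _ _))
    _ ≤ 12 * Real.exp (-(2 * L)) := by linarith

end QuadraticChaos

/-! ### Concatenating the two independent vectors. -/

theorem iIndepFun_sumElim {Ω : Type*} [MeasurableSpace Ω] {μ : Measure Ω} {a b : Type*}
    [Finite a] [Finite b]
    {h : Ω → a → ℝ} {z : Ω → b → ℝ}
    (hh : iIndepFun (fun i ω => h ω i) μ) (hz : iIndepFun (fun i ω => z ω i) μ)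
    (hhz : IndepFun h z μ) :
    iIndepFun (fun (i : a ⊕ b) ω => Sum.elim (h ω) (z ω) i) μ := by
  rw [iIndepFun_iff_measure_inter_preimage_eq_mul] at hh hz ⊢
  intro S sets H
  have hL := hh S.toLeft (sets := fun i => sets (Sum.inl i))
    fun i hi => H _ (Finset.mem_toLeft.1 hi)
  have hR := hz S.toRight (sets := fun i => sets (Sum.inr i))
    fun i hi => H _ (Finset.mem_toRight.1 hi)
  have eL : h ⁻¹' (⋂ i ∈ S.toLeft, (fun x : a → ℝ => x i) ⁻¹' sets (Sum.inl i)) =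
      ⋂ i ∈ S.toLeft, (fun ω => h ω i) ⁻¹' sets (Sum.inl i) := by
    simp only [Set.preimage_iInter]; rfl
  have eR : z ⁻¹' (⋂ i ∈ S.toRight, (fun x : b → ℝ => x i) ⁻¹' sets (Sum.inr i)) =
      ⋂ i ∈ S.toRight, (fun ω => z ω i) ⁻¹' sets (Sum.inr i) := by
    simp only [Set.preimage_iInter]; rfl
  have hprod : ∏ i ∈ S, μ ((fun ω => Sum.elim (h ω) (z ω) i) ⁻¹' sets i) =
      (∏ i ∈ S.toLeft, μ ((fun ω => h ω i) ⁻¹' sets (Sum.inl i))) *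
        ∏ i ∈ S.toRight, μ ((fun ω => z ω i) ⁻¹' sets (Sum.inr i)) := by
    conv_lhs => rw [← Finset.toLeft_disjSum_toRight (u := S)]
    rw [Finset.prod_disjSum]
    rfl
  rw [hprod, ← hL, ← hR, ← eL, ← eR, ← hhz.measure_inter_preimage_eq_mul]
  · congr 1
    ext ω
    simp only [Set.mem_iInter, Set.mem_inter_iff, Set.mem_preimage, Sum.forall,
      Finset.mem_toLeft, Finset.mem_toRight, Sum.elim_inl, Sum.elim_inr]
  · exact MeasurableSet.iInter fun i => MeasurableSet.iInter fun hi =>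
      measurable_pi_apply i (H _ (Finset.mem_toLeft.1 hi))
  · exact MeasurableSet.iInter fun i => MeasurableSet.iInter fun hi =>
      measurable_pi_apply i (H _ (Finset.mem_toRight.1 hi))

theorem IsISG.isCenteredSG_sumElim {Ω : Type*} [MeasurableSpace Ω] {μ : Measure Ω} {a b : Type*}
    [Finite a] [Finite b] {h : Ω → a → ℝ} {z : Ω → b → ℝ} {σ η κ : ℝ}
    (hh : IsISG h σ κ μ) (hz : IsISG z η κ μ) (hhz : IndepFun h z μ) :
    IsCenteredSG (fun ω => Sum.elim (h ω) (z ω)) κ μ where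
  measurable := by rintro (i | i); exacts [hh.measurable i, hz.measurable i]
  indep := iIndepFun_sumElim hh.indep hz.indep hhz
  mean := by rintro (i | i); exacts [hh.mean i, hz.mean i]
  subGaussian := by rintro (i | i); exacts [hh.subGaussian i, hz.subGaussian i]

/-! ### Uniqueness of the Moore-Penrose inverse; norms as traces. -/

theorem IsMoorePenroseInverse.unique {m k : Type*} [Fintype m] [Fintype k]
    {A : Matrix m k ℝ} {R R' : Matrix k m ℝ} (h : IsMoorePenroseInverse A R)
    (h' : IsMoorePenroseInverse A R') : R = R' := by
  have e1 : A * R = A * R' := by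
    calc A * R = A * R' * A * R := by rw [h'.mul_mul_left]
      _ = (A * R')ᵀ * (A * R)ᵀ := by rw [h.symm_left, h'.symm_left, Matrix.mul_assoc (A * R')]
      _ = (A * R * A * R')ᵀ := by rw [← Matrix.transpose_mul, Matrix.mul_assoc (A * R)]
      _ = A * R' := by rw [h.mul_mul_left, h'.symm_left]
  have e2 : R * A = R' * A := by
    calc R * A = R * (A * R' * A) := by rw [h'.mul_mul_left]
      _ = (R * A)ᵀ * (R' * A)ᵀ := by rw [h.symm_right, h'.symm_right]; simp only [Matrix.mul_assoc]
      _ = (R' * (A * R * A))ᵀ := by rw [← Matrix.transpose_mul]; simp only [Matrix.mul_assoc]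
      _ = R' * A := by rw [h.mul_mul_left, h'.symm_right]
  calc R = R * A * R := h.mul_mul_right.symm
    _ = R' * (A * R) := by rw [e2, Matrix.mul_assoc]
    _ = R' := by rw [e1, ← Matrix.mul_assoc, h'.mul_mul_right]

theorem vecNorm_sq {k : Type*} [Fintype k] (v : k → ℝ) : vecNorm v ^ 2 = v ⬝ᵥ v := by
  rw [vecNorm, EuclideanSpace.real_norm_sq_eq, dotProduct]
  exact Finset.sum_congr rfl fun i _ => pow_two _

theorem hsNorm_sq {m k : Type*} [Fintype m] [Fintype k] (A : Matrix m k ℝ) :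
    hsNorm A ^ 2 = ∑ i, ∑ j, A i j ^ 2 :=
  Real.sq_sqrt (Finset.sum_nonneg fun _ _ => Finset.sum_nonneg fun _ _ => sq_nonneg _)

theorem sum_sq_eq_trace {m k : Type*} [Fintype m] [Fintype k] (A : Matrix m k ℝ) :
    ∑ i, ∑ j, A i j ^ 2 = (A * Aᵀ).trace := by
  simp [Matrix.trace, Matrix.mul_apply, pow_two]

/-! ### Lower bound on the singular values. -/

/-- Each `x s` is a difference of consecutive tail sums, and `(a - b)² ≤ 2a² + 2b²`. -/
theorem sum_sq_le_four_mul_sum_tail_sq {T : ℕ} (x : Fin T → ℝ) :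
    ∑ s, x s ^ 2 ≤ 4 * ∑ s, (∑ t ∈ Finset.Ici s, x t) ^ 2 := by
  set y : ℕ → ℝ := fun k => ∑ t ∈ Finset.univ.filter (fun t : Fin T => k ≤ (t : ℕ)), x t with hy
  have h1 : ∀ s : Fin T, ∑ t ∈ Finset.Ici s, x t = y s := by
    intro s
    simp only [hy]
    exact Finset.sum_congr (by ext; simp) fun _ _ => rfl
  have h2 : ∀ s : Fin T, y s = x s + y (s + 1) := by
    intro s
    rw [← h1, ← Finset.Ioi_insert, Finset.sum_insert (by simp)]
    congr 1
    simp only [hy]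
    exact Finset.sum_congr (by ext t; simp) fun _ _ => rfl
  -- The empty tail vanishes, so shifting the index does not increase the sum of squares.
  have hT : y T = 0 := Finset.sum_eq_zero fun t ht => by
    have := (Finset.mem_filter.1 ht).2; have := t.2; omega
  have h3 : ∑ s : Fin T, y (s + 1) ^ 2 ≤ ∑ s : Fin T, y s ^ 2 := by
    rw [Fin.sum_univ_eq_sum_range (fun k => y (k + 1) ^ 2), Fin.sum_univ_eq_sum_range
      (fun k => y k ^ 2)]
    have e1 := Finset.sum_range_succ (fun k => y k ^ 2) T
    have e2 := Finset.sum_range_succ' (fun k => y k ^ 2) T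
    rw [hT] at e1
    nlinarith [sq_nonneg (y 0)]
  simp_rw [h1]
  calc ∑ s, x s ^ 2 ≤ ∑ s : Fin T, (2 * y s ^ 2 + 2 * y (s + 1) ^ 2) := by
        refine Finset.sum_le_sum fun s _ => ?_
        have := h2 s
        have : x s = y s - y (s + 1) := by linarith
        rw [this]
        nlinarith [sq_nonneg (y s + y (s + 1))]
    _ ≤ _ := by rw [Finset.sum_add_distrib, ← Finset.mul_sum, ← Finset.mul_sum]; linarith

theorem vecMul_obsMat_mul_sumMat {T n : ℕ} (u : Fin T → EuclideanSpace ℝ (Fin n)) (v : Fin T → ℝ)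
    (s : Fin T) (j : Fin n) :
    (v ᵥ* (obsMat u * sumMat T n)) (s, j) = ∑ t ∈ Finset.Ici s, v t * u t j := by
  have hO : v ᵥ* obsMat u = fun b => v b.1 * u b.1 b.2 := by
    ext b
    simp [Matrix.vecMul, dotProduct, obsMat]
  rw [← Matrix.vecMul_vecMul, hO]
  simp only [Matrix.vecMul, dotProduct, sumMat, Matrix.of_apply, Fintype.sum_prod_type, mul_ite,
    mul_one, mul_zero, ite_and]
  rw [← Finset.sum_subset (Finset.subset_univ (Finset.Ici s))]
  · exact Finset.sum_congr rfl fun t ht => by simp [Finset.mem_Ici.1 ht]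
  · intro t _ ht
    have : ¬ s ≤ t := by simpa using ht
    simp [this]

/-- For `v` the `i`-th column of `U`, `γ i` is the norm of `v ᵥ* A`, whose entries are tail sums of
the vectors `v t • u t`. The tail-sum inequality in each coordinate `j` bounds it below by half the
norm of that family. -/
theorem SVD.inv_sq_le {T n : ℕ} {u : Fin T → EuclideanSpace ℝ (Fin n)} (hu : ∀ t, u t ≠ 0)
    (D : SVD (obsMat u * sumMat T n)) (i : Fin T) :
    (D.γ i)⁻¹ ^ 2 ≤ 4 * ((⨅ t, ‖u t‖) ^ 2)⁻¹ := by
  have : Nonempty (Fin T) := ⟨i⟩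
  set m := ⨅ t, ‖u t‖ with hm
  have hmle : ∀ t, m ≤ ‖u t‖ := fun t => ciInf_le (Set.finite_range _).bddBelow t
  have hmpos : 0 < m := by
    obtain ⟨t, ht⟩ := exists_eq_ciInf_of_finite (f := fun t => ‖u t‖)
    rw [hm, ← ht]
    exact norm_pos_iff.2 (hu t)
  set v : Fin T → ℝ := fun t => D.U t i with hv
  have hv1 : ∑ t, v t ^ 2 = 1 := by
    have := congrFun (congrFun D.orth_U i) i
    simpa [Matrix.mul_apply, pow_two] using this
  have hvA : ∀ b, (v ᵥ* (obsMat u * sumMat T n)) b = D.γ i * D.W i b := by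
    intro b
    have h1 : D.Uᵀ * (obsMat u * sumMat T n) = Matrix.diagonal D.γ * D.W := by
      calc _ = D.Uᵀ * (D.U * Matrix.diagonal D.γ * D.W) := congrArg _ D.eq
        _ = _ := by rw [← Matrix.mul_assoc, ← Matrix.mul_assoc, D.orth_U, Matrix.one_mul]
    have h2 := congrFun (congrFun h1 i) b
    rw [Matrix.diagonal_mul] at h2
    rw [← h2]
    rfl
  have hW : ∑ b, D.W i b ^ 2 = 1 := by
    have := congrFun (congrFun D.orth_W i) i
    simpa [Matrix.mul_apply, pow_two] using this
  have hγ : ∑ b, (v ᵥ* (obsMat u * sumMat T n)) b ^ 2 = D.γ i ^ 2 := by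
    simp_rw [hvA, mul_pow, ← Finset.mul_sum]
    rw [hW, mul_one]
  have key : m ^ 2 ≤ 4 * D.γ i ^ 2 := by
    calc m ^ 2 = ∑ t, v t ^ 2 * m ^ 2 := by rw [← Finset.sum_mul, hv1, one_mul]
      _ ≤ ∑ t, v t ^ 2 * ‖u t‖ ^ 2 := by
        refine Finset.sum_le_sum fun t _ => ?_
        have := hmle t
        gcongr
      _ = ∑ j, ∑ t, (v t * u t j) ^ 2 := by
        rw [Finset.sum_comm]
        refine Finset.sum_congr rfl fun t _ => ?_
        rw [EuclideanSpace.real_norm_sq_eq, Finset.mul_sum]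
        simp only [mul_pow]
      _ ≤ ∑ j, 4 * ∑ s, (∑ t ∈ Finset.Ici s, v t * u t j) ^ 2 :=
        Finset.sum_le_sum fun j _ => sum_sq_le_four_mul_sum_tail_sq _
      _ = 4 * D.γ i ^ 2 := by
        rw [← hγ, Fintype.sum_prod_type, ← Finset.mul_sum, Finset.sum_comm]
        simp_rw [vecMul_obsMat_mul_sumMat]
  have := D.pos i
  rw [← div_eq_mul_inv, inv_pow, le_div_iff₀ (by positivity), inv_mul_le_iff₀ (by positivity)]
  linarith

/-! ### The estimator as a quadratic form: Hilbert-Schmidt norm and mean. -/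

section QuadraticForm

variable {T : ℕ} {k : Type*} [Fintype k] {A : Matrix (Fin T) k ℝ} (D : SVD A) (p : ℕ)

/-- `Wᵀ` times this matrix is `[R' A | R']`, with `R'` the truncated pseudo-inverse of `A`. -/
noncomputable def SVD.truncFactor : Matrix (Fin T) (k ⊕ Fin T) ℝ :=
  Matrix.fromCols (Matrix.diagonal (fun i : Fin T => if T - p ≤ (i : ℕ) then (1 : ℝ) else 0) * D.W)
    (Matrix.diagonal (fun i : Fin T => if T - p ≤ (i : ℕ) then (D.γ i)⁻¹ else 0) * D.Uᵀ)

theorem SVD.truncPinv_mul :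
    D.truncPinv p * A =
      D.Wᵀ * (Matrix.diagonal (fun i : Fin T => if T - p ≤ (i : ℕ) then (1 : ℝ) else 0) * D.W) := by
  have hd : Matrix.diagonal (fun i : Fin T => if T - p ≤ (i : ℕ) then (D.γ i)⁻¹ else 0) *
      Matrix.diagonal D.γ = Matrix.diagonal (fun i : Fin T => if T - p ≤ (i : ℕ) then (1 : ℝ) else 0) := by
    rw [Matrix.diagonal_mul_diagonal]
    congr 1; ext i
    have := (D.pos i).ne'
    split_ifs <;> simp [this]
  rw [← hd]
  calc D.truncPinv p * A = D.truncPinv p * (D.U * Matrix.diagonal D.γ * D.W) :=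
        congrArg _ D.eq
    _ = D.Wᵀ * (Matrix.diagonal (fun i : Fin T => if T - p ≤ (i : ℕ) then (D.γ i)⁻¹ else 0) *
        (D.Uᵀ * D.U) * Matrix.diagonal D.γ * D.W) := by
        simp only [SVD.truncPinv, Matrix.mul_assoc]
    _ = _ := by rw [D.orth_U, Matrix.mul_one]

theorem SVD.truncPinv_mulVec (x : k → ℝ) (z : Fin T → ℝ) :
    D.truncPinv p *ᵥ (A *ᵥ x + z) = D.Wᵀ *ᵥ (D.truncFactor p *ᵥ Sum.elim x z) := by
  rw [Matrix.mulVec_add, Matrix.mulVec_mulVec, D.truncPinv_mul, SVD.truncFactor,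
    Matrix.fromCols_mulVec_sumElim, Matrix.mulVec_add, Matrix.mulVec_mulVec, Matrix.mulVec_mulVec,
    SVD.truncPinv, Matrix.mul_assoc D.Wᵀ]

theorem SVD.vecNorm_truncPinv_sq (x : k → ℝ) (z : Fin T → ℝ) :
    vecNorm (D.truncPinv p *ᵥ (A *ᵥ x + z)) ^ 2 =
      ∑ i, ∑ j, ((D.truncFactor p)ᵀ * D.truncFactor p) i j * Sum.elim x z i * Sum.elim x z j := by
  have hiso : ∀ v : Fin T → ℝ, (D.Wᵀ *ᵥ v) ⬝ᵥ (D.Wᵀ *ᵥ v) = v ⬝ᵥ v := by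
    intro v
    rw [Matrix.dotProduct_mulVec, Matrix.vecMul_mulVec]
    simp [D.orth_W]
  rw [vecNorm_sq, D.truncPinv_mulVec, hiso, Matrix.dotProduct_mulVec, Matrix.vecMul_mulVec,
    ← Matrix.dotProduct_mulVec]
  simp only [dotProduct, Matrix.mulVec, Finset.mul_sum]
  exact Finset.sum_congr rfl fun i _ => Finset.sum_congr rfl fun j _ => by ring

theorem sum_truncation (hp : p ≤ T) (f : ℝ) :
    ∑ i : Fin T, (if T - p ≤ (i : ℕ) then f else 0) = p * f := by
  rw [Fin.sum_univ_eq_sum_range (fun i => if T - p ≤ i then f else 0), ← Finset.sum_filter,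
    Finset.sum_const, nsmul_eq_mul]
  have : (Finset.range T).filter (fun i => T - p ≤ i) = Finset.Ico (T - p) T := by
    ext i; simp [and_comm]
  rw [this, Nat.card_Ico, Nat.sub_sub_self hp]

theorem SVD.truncFactor_mul_transpose :
    D.truncFactor p * (D.truncFactor p)ᵀ = Matrix.diagonal
      (fun i : Fin T => if T - p ≤ (i : ℕ) then 1 + (D.γ i)⁻¹ ^ 2 else 0) := by
  rw [SVD.truncFactor, Matrix.transpose_fromCols, Matrix.fromCols_mul_fromRows]
  simp only [Matrix.transpose_mul, Matrix.diagonal_transpose, Matrix.transpose_transpose]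
  have h1 : ∀ d : Fin T → ℝ, Matrix.diagonal d * D.W * (D.Wᵀ * Matrix.diagonal d) =
      Matrix.diagonal fun i => d i * d i := by
    intro d
    calc _ = Matrix.diagonal d * (D.W * D.Wᵀ) * Matrix.diagonal d := by
          simp only [Matrix.mul_assoc]
      _ = _ := by rw [D.orth_W, Matrix.mul_one, Matrix.diagonal_mul_diagonal]
  have h2 : ∀ d : Fin T → ℝ, Matrix.diagonal d * D.Uᵀ * (D.U * Matrix.diagonal d) =
      Matrix.diagonal fun i => d i * d i := by
    intro d
    calc _ = Matrix.diagonal d * (D.Uᵀ * D.U) * Matrix.diagonal d := by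
          simp only [Matrix.mul_assoc]
      _ = _ := by rw [D.orth_U, Matrix.mul_one, Matrix.diagonal_mul_diagonal]
  rw [h1, h2, Matrix.diagonal_add]
  congr 1; ext i
  split_ifs <;> ring

/-- Cyclicity of the trace replaces `Gᵀ G` by the diagonal matrix `G Gᵀ`, which has only `p` nonzero
entries. -/
theorem SVD.sum_sq_quadraticForm_le (hp : p ≤ T) {M : ℝ} (hM : ∀ i, 1 + (D.γ i)⁻¹ ^ 2 ≤ M) :
    ∑ i, ∑ j, ((D.truncFactor p)ᵀ * D.truncFactor p) i j ^ 2 ≤ p * M ^ 2 := by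
  set G := D.truncFactor p with hG
  rw [sum_sq_eq_trace]
  have : (Gᵀ * G * (Gᵀ * G)ᵀ).trace = (G * Gᵀ * (G * Gᵀ)).trace := by
    rw [Matrix.transpose_mul, Matrix.transpose_transpose, Matrix.mul_assoc Gᵀ,
      Matrix.trace_mul_comm]
    simp only [Matrix.mul_assoc]
  rw [this, hG, D.truncFactor_mul_transpose, Matrix.diagonal_mul_diagonal, Matrix.trace_diagonal,
    ← sum_truncation p hp]
  refine Finset.sum_le_sum fun i _ => ?_
  have := hM i
  split_ifs
  · rw [pow_two M]
    exact mul_self_le_mul_self (by positivity) this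
  · simp

/-- This is the mean of the form: the `k` block of `G` consists of `p` unit rows of `W`, and the
other block has the Hilbert-Schmidt norm of `R'`, since `Wᵀ` preserves it. -/
theorem SVD.sum_diag_quadraticForm (hp : p ≤ T) (a b : ℝ) :
    ∑ i, ((D.truncFactor p)ᵀ * D.truncFactor p) i i * Sum.elim (fun _ => a) (fun _ => b) i =
      p * a + hsNorm (D.truncPinv p) ^ 2 * b := by
  have hcol : ∀ i, ((D.truncFactor p)ᵀ * D.truncFactor p) i i = ∑ r, D.truncFactor p r i ^ 2 := by
    intro i; simp [Matrix.mul_apply, pow_two]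
  simp_rw [hcol]
  rw [Fintype.sum_sum_type]
  simp only [Sum.elim_inl, Sum.elim_inr, ← Finset.sum_mul]
  congr 2
  · rw [Finset.sum_comm]
    simp only [SVD.truncFactor, Matrix.fromCols_apply_inl]
    rw [← mul_one (p : ℝ), ← sum_truncation p hp]
    refine Finset.sum_congr rfl fun i _ => ?_
    have hW : ∑ b, D.W i b ^ 2 = 1 := by
      have := congrFun (congrFun D.orth_W i) i
      simpa [Matrix.mul_apply, pow_two] using this
    simp only [Matrix.diagonal_mul, mul_pow, ← Finset.mul_sum, hW]
    split_ifs <;> norm_num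
  · rw [hsNorm_sq, Finset.sum_comm]
    simp only [SVD.truncFactor, Matrix.fromCols_apply_inr]
    rw [sum_sq_eq_trace, sum_sq_eq_trace, SVD.truncPinv, Matrix.mul_assoc D.Wᵀ]
    set E := Matrix.diagonal (fun i : Fin T => if T - p ≤ (i : ℕ) then (D.γ i)⁻¹ else 0) * D.Uᵀ
    rw [Matrix.transpose_mul D.Wᵀ E, Matrix.transpose_transpose, Matrix.trace_mul_comm (D.Wᵀ * E),
      Matrix.mul_assoc Eᵀ, ← Matrix.mul_assoc D.W, D.orth_W, Matrix.one_mul,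
      Matrix.trace_mul_comm]

end QuadraticForm

/-! ### Assembling the deviation bound. -/

theorem SVD.measureReal_truncPinv_le {T n : ℕ} {u : Fin T → EuclideanSpace ℝ (Fin n)}
    (hu : ∀ t, u t ≠ 0) {Ω : Type*} [MeasurableSpace Ω] {μ : Measure Ω} [IsProbabilityMeasure μ]
    {σ η κ : ℝ} (hκ : 0 < κ) {h : Ω → Fin T × Fin n → ℝ} {z : Ω → Fin T → ℝ}
    (hh : IsISG h σ κ μ) (hz : IsISG z η κ μ) (hhz : IndepFun h z μ) {δ : ℝ} (hδ : 0 < δ)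
    (D : SVD (obsMat u * sumMat T n)) {p : ℕ} (hp0 : 0 < p) (hp : p ≤ T) :
    μ.real {ω | 1024 * ((1 + κ ^ 2) * (1 + ((⨅ t, ‖u t‖) ^ 2)⁻¹) * Real.log (1 / δ)) / √(p : ℝ) ≤
      |vecNorm (D.truncPinv p *ᵥ ((obsMat u * sumMat T n) *ᵥ h ω + z ω)) ^ 2 / p -
        (σ ^ 2 + hsNorm (D.truncPinv p) ^ 2 / p * η ^ 2)|} ≤ 4 * δ := by
  -- For `δ ≥ 1/4` the bound `4 δ` is trivial; below that, `12 exp(-2L) = 12 δ² ≤ 4 δ`.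
  rcases le_or_gt (1 / 4) δ with h4 | h4
  · exact measureReal_le_one.trans (by linarith)
  set L := Real.log (1 / δ) with hL
  set m := ((⨅ t, ‖u t‖) ^ 2)⁻¹ with hm
  have hm0 : 0 ≤ m := by positivity
  have hL4 : Real.log 4 ≤ L := by
    refine Real.log_le_log (by norm_num) ?_
    rw [le_div_iff₀ hδ]; linarith
  have hexpL : Real.exp (-L) = δ := by
    rw [hL, Real.exp_neg, Real.exp_log (by positivity)]; simp
  have hL0 : 0 ≤ L := (Real.log_nonneg (by norm_num)).trans hL4
  have hpR : (0 : ℝ) < p := by exact_mod_cast hp0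
  have hsp : 0 < √(p : ℝ) := Real.sqrt_pos.2 hpR
  have hspp : √(p : ℝ) * √(p : ℝ) = p := Real.mul_self_sqrt hpR.le
  have hF : 0 < √(p : ℝ) * (1 + 4 * m) := by positivity
  have hq : ∑ i, ∑ j, ((D.truncFactor p)ᵀ * D.truncFactor p) i j ^ 2 ≤
      (√(p : ℝ) * (1 + 4 * m)) ^ 2 := by
    rw [mul_pow, Real.sq_sqrt hpR.le]
    exact D.sum_sq_quadraticForm_le p hp fun i => by linarith [D.inv_sq_le hu i]
  have main := (hh.isCenteredSG_sumElim hz hhz).measureReal_quadraticForm_le hκ _ hF hq L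
  have hmom : ∀ i, ∫ ω, Sum.elim (h ω) (z ω) i ^ 2 ∂μ =
      Sum.elim (fun _ => σ ^ 2) (fun _ => η ^ 2) i := by
    rintro (i | i); exacts [hh.second_moment i, hz.second_moment i]
  simp_rw [hmom, ← D.vecNorm_truncPinv_sq] at main
  rw [D.sum_diag_quadraticForm p hp] at main
  refine (measureReal_mono fun ω hω => ?_).trans (main.trans ?_)
  · set Q := vecNorm (D.truncPinv p *ᵥ ((obsMat u * sumMat T n) *ᵥ h ω + z ω)) ^ 2 with hQ
    set H := hsNorm (D.truncPinv p) ^ 2 with hH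
    have hω' : 1024 * ((1 + κ ^ 2) * (1 + m) * L) / √(p : ℝ) ≤
      |Q / p - (σ ^ 2 + H / p * η ^ 2)| := hω
    have e : Q / p - (σ ^ 2 + H / p * η ^ 2) = (Q - (p * σ ^ 2 + H * η ^ 2)) / p := by
      field_simp
    rw [e, abs_div, abs_of_pos hpR, div_le_div_iff₀ hsp hpR] at hω'
    have hω'' : 1024 * ((1 + κ ^ 2) * (1 + m) * L) * √(p : ℝ) * √(p : ℝ) ≤
        |Q - (p * σ ^ 2 + H * η ^ 2)| * √(p : ℝ) := by
      rwa [mul_assoc _ √(p : ℝ), hspp]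
    refine le_trans ?_ (le_of_mul_le_mul_right hω'' hsp)
    -- The factor 4 from the singular value bound turns 256 into 1024.
    have hle : κ ^ 2 * (1 + 4 * m) ≤ 4 * ((1 + κ ^ 2) * (1 + m)) := by nlinarith [sq_nonneg κ]
    nlinarith [mul_le_mul_of_nonneg_right hle (mul_nonneg hsp.le hL0)]
  · have h1 : Real.exp (-(2 * L)) = δ * δ := by
      rw [← hexpL, ← Real.exp_add]; ring_nf
    rw [h1]
    nlinarith

end VarEst

theorem theorem1 :
    ∃ c : ℝ, 0 < c ∧
      ∀ (T n : ℕ), 0 < T →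
      ∀ (u : Fin T → EuclideanSpace ℝ (Fin n)), (∀ t, u t ≠ 0) →
      ∀ (Ω : Type*) [MeasurableSpace Ω] (μ : Measure Ω) [IsProbabilityMeasure μ]
        (σ η κ : ℝ), 0 < κ →
      ∀ (h : Ω → Fin T × Fin n → ℝ) (z : Ω → Fin T → ℝ) (Y : Ω → Fin T → ℝ),
        VarEst.IsISG h σ κ μ → VarEst.IsISG z η κ μ → IndepFun h z μ →
        (∀ ω, Y ω = (VarEst.obsMat u * VarEst.sumMat T n) *ᵥ h ω + z ω) →
      ∀ δ : ℝ, 0 < δ → δ < 1 →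
        (∀ R : Matrix (Fin T × Fin n) (Fin T) ℝ,
          VarEst.IsMoorePenroseInverse (VarEst.obsMat u * VarEst.sumMat T n) R →
          μ.real {ω | c * ((1 + κ ^ 2) * (1 + ((⨅ t, ‖u t‖) ^ 2)⁻¹) * Real.log (1 / δ)) / √(T : ℝ) ≤
            |VarEst.vecNorm (R *ᵥ Y ω) ^ 2 / T - (σ ^ 2 + VarEst.hsNorm R ^ 2 / T * η ^ 2)|}
            ≤ 4 * δ) ∧
        (∀ (D : VarEst.SVD (VarEst.obsMat u * VarEst.sumMat T n)) (p : ℕ), 0 < p → p ≤ T →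
          μ.real {ω | c * ((1 + κ ^ 2) * (1 + ((⨅ t, ‖u t‖) ^ 2)⁻¹) * Real.log (1 / δ)) / √(p : ℝ) ≤
            |VarEst.vecNorm (D.truncPinv p *ᵥ Y ω) ^ 2 / p -
              (σ ^ 2 + VarEst.hsNorm (D.truncPinv p) ^ 2 / p * η ^ 2)|}
            ≤ 4 * δ) := by
  refine ⟨1024, by norm_num, ?_⟩
  intro T n hT u hu Ω _ μ _ σ η κ hκ h z Y hh hz hhz hY δ hδ _
  have main := fun (D : VarEst.SVD (VarEst.obsMat u * VarEst.sumMat T n)) (p : ℕ) (hp0 : 0 < p)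
    (hp : p ≤ T) => D.measureReal_truncPinv_le hu hκ hh hz hhz hδ hp0 hp
  simp_rw [← hY] at main
  refine ⟨fun R hR => ?_, main⟩
  -- By uniqueness, `R` is the case `p = T` of any decomposition, and one exists because all `u t`
  -- are nonzero.
  obtain ⟨D⟩ := VarEst.svd_nonempty u hu
  rw [hR.unique D.isMoorePenroseInverse]
  exact main D T hT le_rfl
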